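/- **Setting.** All alphabets $\mathcal U,\mathcal W,\mathcal X,\mathcal Y,\mathcal V$ are finite, logarithms, entropies and informations are in base 2, $\bar P_U$ is a given i.i.d. source and $\bar P_{Y|X}$ a given discrete memoryless channel. For a block length $n\ge 1$, a code of common randomness rate $R_0\ge 0$ is a pair of (possibly randomized) maps $f_n:\mathcal U^n\times\{1,\dots,\lfloor 2^{nR_0}\rfloor\}\to\mathcal X^n$ and $g_n:\mathcal Y^n\times\{1,\dots,\lfloor 2^{nR_0}\rfloor\}\to\mathcal V^n$, that is, a pair of conditional distributions of $X^n$ given $(U^n,C)$ and of $V^n$ given $(Y^n,C)$. Here $C$ is uniform and independent of $U^n\sim\bar P_U^{\otimes n}$, and $Y^n$ is the output of $\bar P_{Y|X}^{\otimes n}$ for the input $X^n$. The pair $(\bar P_{UXYV},R_0)$ is $(\varepsilon,n)$-achievable if some code of rate $R_0$ induces a distribution with $\|P_{U^nX^nY^nV^n}-\bar P_{UXYV}^{\otimes n}\|_1\le\varepsilon$, where $\|\cdot\|_1$ is the sum of absolute differences. The fixed-length strong coordination region $\mathcal R(n,\varepsilon)$ is the closure of the set of $(\varepsilon,n)$-achievable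 pairs. Let $Q(t)=\int_t^\infty \frac1{\sqrt{2\pi}}e^{-x^2/2}dx$. For a joint distribution $\bar P=\bar P_{UWXYV}$, let $V_{\bar P}$ be the dispersion of the channel $\bar P_{Y|W}$ (with inputs the $w$ such that $\bar P_W(w)>0$), namely the minimum of $\mathbb E_W[\mathrm{Var}(\imath(W;Y)\mid W)]$ over its capacity-achieving input distributions, where $\imath$ is the information density of that input distribution and the channel. Put $$c_1(\bar P)=H(U,W)+H(U),\qquad c_3(\bar P)=H(U,W,X,Y,V)+H(W).$$ Let $B(\bar P)\ge 0$ and $\kappa(\bar P,\varepsilon_1,n)\ge0$ be given coefficients and, for $\varepsilon_1>0$, $\varepsilon_5\ge0$, put $\varepsilon_4=\varepsilon_5+B(\bar P)/\sqrt n$ and $$\Delta=\kappa(\bar P,\varepsilon_1,n)\frac{\log n}{n}+Q^{-1}(\varepsilon_4)\sqrt{\frac{V_{\bar P}}{n}} .$$ Let $\mathcal R_{\rm in}(n,\varepsilon_1,\varepsilon_5)$ be the set of pairs $(\bar P_{UXYV},R_0)$ for which there is a joint distribution $\bar P_{UWXYV}$ with marginal $\bar P_{UXYV}$ such that $0<\varepsilon_4\le\frac12$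 and $$\bar P_{UWXYV}=\bar P_U\,\bar P_{W|U}\,\bar P_{X|UW}\,\bar P_{Y|X}\,\bar P_{V|WY},$$ $$I(W;U)\le I(W;Y)-c_1(\bar P)\,\varepsilon_1-\Delta,\qquad R_0\ge I(W;UXV|Y)+c_3(\bar P)\,\varepsilon_1+\Delta .$$ **Theorem (Inner bound).** Let $\bar P_U$, $\bar P_{Y|X}$, the alphabets and any function $B(\bar P)\ge0$ be given. There is $\kappa(\bar P,\varepsilon_1,n)\ge 0$ which, for fixed $\bar P$ and $\varepsilon_1>0$, is bounded in $n\ge1$ (so that $\kappa\frac{\log n}{n}=O(\frac{\log n}{n})$), which equals $\frac32$ for all $n\ge1$ and $\varepsilon_1>0$ with $n\varepsilon_1^2\ge A(\bar P)\ln n$, where $A(\bar P)>0$ depends only on $\bar P$ (once the data above are given), and is such that for all $n\ge1$, $\varepsilon_1>0$ and $\varepsilon_5\ge0$ $$\mathcal R_{\rm in}(n,\varepsilon_1,\varepsilon_5)\subseteq\mathcal R\Big(n,\;10\,\varepsilon_5+\frac{10+2\sqrt2}{\sqrt n}\Big).$$ -/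

import Mathlib

namespace StrongCoord

noncomputable section

/-! ### Information measures of finite distributions (logarithms in base 2)

A distribution on a finite type `Ω` is a function `Ω → ℝ` in `stdSimplex ℝ Ω`; a random variable is
a function on `Ω`. -/

section Information

variable {Ω α β γ : Type*} [Fintype Ω] [Fintype α] [Fintype β] [Fintype γ]

open Classical in
/-- The distribution of the random variable `A` under `p`. -/
def law (p : Ω → ℝ) (A : Ω → α) (a : α) : ℝ :=
  ∑ ω, if A ω = a then p ω else 0

/-- The entropy `H(A)`, in bits. -/
def entropy (p : Ω → ℝ) (A : Ω → α) : ℝ :=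
  ∑ a, Real.negMulLog (law p A a) / Real.log 2

/-- The conditional entropy `H(A|B)`. -/
def condEntropy (p : Ω → ℝ) (A : Ω → α) (B : Ω → β) : ℝ :=
  entropy p (fun ω => (A ω, B ω)) - entropy p B

/-- The mutual information `I(A;B)`. -/
def mutualInfo (p : Ω → ℝ) (A : Ω → α) (B : Ω → β) : ℝ :=
  entropy p A - condEntropy p A B

/-- The conditional mutual information `I(A;B|C)`. -/
def condMutualInfo (p : Ω → ℝ) (A : Ω → α) (B : Ω → β) (C : Ω → γ) : ℝ :=
  condEntropy p A C - condEntropy p A (fun ω => (B ω, C ω))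

/-- The conditional distribution `P_{B|A}(b|a)`; meaningful when `P_A(a) > 0`. -/
def condLaw (p : Ω → ℝ) (A : Ω → α) (B : Ω → β) (a : α) (b : β) : ℝ :=
  law p (fun ω => (A ω, B ω)) (a, b) / law p A a

end Information

/-! ### Channel dispersion -/

section Dispersion

variable {α β : Type*} [Fintype α] [Fintype β]

/-- The output distribution of the channel `K` for the input distribution `q`. -/
def outputLaw (K : α → β → ℝ) (q : α → ℝ) (b : β) : ℝ := ∑ a, q a * K a b

/-- The information density `log₂ (K(b|a) / (qK)(b))`. -/
def infoDensity (K : α → β → ℝ) (q : α → ℝ) (a : α) (b : β) : ℝ :=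
  Real.logb 2 (K a b / outputLaw K q b)

/-- The expectation of the information density given the input `a`. -/
def infoMean (K : α → β → ℝ) (q : α → ℝ) (a : α) : ℝ :=
  ∑ b, K a b * infoDensity K q a b

/-- The mutual information between the input and the output of `K` for the input distribution
`q`. -/
def channelInfo (K : α → β → ℝ) (q : α → ℝ) : ℝ := ∑ a, q a * infoMean K q a

/-- The conditional information variance: the average over the input `a ∼ q` of the variance, under
`K(·|a)`, of the information density. -/
def condInfoVariance (K : α → β → ℝ) (q : α → ℝ) : ℝ :=
  ∑ a, q a * ∑ b, K a b * (infoDensity K q a b - infoMean K q a) ^ 2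

/-- The input distributions of the channel `K` with input alphabet `S ⊆ α`. -/
def inputLaws (S : Set α) : Set (α → ℝ) := {q | q ∈ stdSimplex ℝ α ∧ ∀ a, a ∉ S → q a = 0}

/-- The capacity-achieving input distributions of the channel `K` with input alphabet `S ⊆ α`. -/
def capacityAchieving (K : α → β → ℝ) (S : Set α) : Set (α → ℝ) :=
  {q | q ∈ inputLaws S ∧ ∀ q' ∈ inputLaws S, channelInfo K q' ≤ channelInfo K q}

/-- The dispersion of the channel `K` with input alphabet `S ⊆ α`: the minimum of the conditional
information variance over the capacity-achieving input distributions. -/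
def dispersion (K : α → β → ℝ) (S : Set α) : ℝ :=
  sInf (condInfoVariance K '' capacityAchieving K S)

end Dispersion

/-! ### The Gaussian tail and its inverse -/

/-- The tail distribution function of the standard normal distribution. -/
def gaussianQ (t : ℝ) : ℝ :=
  ∫ x in Set.Ioi t, (1 / Real.sqrt (2 * Real.pi)) * Real.exp (-x ^ 2 / 2)

/-- The inverse of the continuous, strictly decreasing bijection `gaussianQ : ℝ → (0,1)`. -/
def gaussianQInv (p : ℝ) : ℝ := sInf {t : ℝ | gaussianQ t ≤ p}

/-! ### Codes and fixed-length strong coordination -/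

section Coordination

variable {U X Y V : Type*} [Fintype U] [Fintype X] [Fintype Y] [Fintype V]

/-- A code of block length `n` with common randomness uniform on `M` values. Both maps may use
private randomness: `enc u c` is the conditional distribution of `Xⁿ` given `(Uⁿ, C) = (u, c)`, and
`dec y c` is the conditional distribution of `Vⁿ` given `(Yⁿ, C) = (y, c)`. -/
structure Code (U X Y V : Type*) [Fintype X] [Fintype V] (n M : ℕ) where
  enc : (Fin n → U) → Fin M → (Fin n → X) → ℝ
  enc_mem : ∀ u c, enc u c ∈ stdSimplex ℝ (Fin n → X)
  dec : (Fin n → Y) → Fin M → (Fin n → V) → ℝ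
  dec_mem : ∀ y c, dec y c ∈ stdSimplex ℝ (Fin n → V)

/-- The distribution of `(Uⁿ, Xⁿ, Yⁿ, Vⁿ)` induced by a code, for the i.i.d. source `PU` and the
memoryless channel `PYX`. -/
def Code.induced {n M : ℕ} (c : Code U X Y V n M) (PU : U → ℝ) (PYX : X → Y → ℝ)
    (u : Fin n → U) (x : Fin n → X) (y : Fin n → Y) (v : Fin n → V) : ℝ :=
  ∑ k : Fin M, (1 / (M : ℝ)) *
    ((∏ i, PU (u i)) * c.enc u k x * (∏ i, PYX (x i) (y i)) * c.dec y k v)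

/-- The `L¹` distance between the distribution induced by a code and the i.i.d. target. -/
def Code.l1Dist {n M : ℕ} (c : Code U X Y V n M) (PU : U → ℝ) (PYX : X → Y → ℝ)
    (P : U × X × Y × V → ℝ) : ℝ :=
  ∑ u : Fin n → U, ∑ x : Fin n → X, ∑ y : Fin n → Y, ∑ v : Fin n → V,
    |c.induced PU PYX u x y v - ∏ i, P (u i, x i, y i, v i)|

/-- The target `P` is `(ε, n)`-achievable for strong coordination with common randomness rate `R₀`,
that is, with common randomness uniform on the integers between `1` and `2 ^ (n R₀)`. -/
def Achievable (PU : U → ℝ) (PYX : X → Y → ℝ) (n : ℕ) (ε : ℝ)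
    (P : U × X × Y × V → ℝ) (R₀ : ℝ) : Prop :=
  P ∈ stdSimplex ℝ (U × X × Y × V) ∧ 0 ≤ R₀ ∧
    ∃ c : Code U X Y V n ⌊(2 : ℝ) ^ ((n : ℝ) * R₀)⌋₊, c.l1Dist PU PYX P ≤ ε

/-- The fixed-length strong coordination region for block length `n` and `L¹` distance `ε`. -/
def coordinationRegion (PU : U → ℝ) (PYX : X → Y → ℝ) (n : ℕ) (ε : ℝ) :
    Set ((U × X × Y × V → ℝ) × ℝ) :=
  closure {p | Achievable PU PYX n ε p.1 p.2}

end Coordination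

/-! ### The inner region -/

section Inner

variable {U W X Y V : Type*} [Fintype U] [Fintype W] [Fintype X] [Fintype Y] [Fintype V]

/-- Joint outcomes, in the order `(U, W, X, Y, V)`. -/
abbrev Outcome (U W X Y V : Type*) := U × W × X × Y × V

/-- The coordinate random variables on the space of outcomes. -/
def rvU (ω : Outcome U W X Y V) : U := ω.1
def rvW (ω : Outcome U W X Y V) : W := ω.2.1
def rvX (ω : Outcome U W X Y V) : X := ω.2.2.1
def rvY (ω : Outcome U W X Y V) : Y := ω.2.2.2.1
def rvV (ω : Outcome U W X Y V) : V := ω.2.2.2.2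

/-- `J = P_U P_{W|U} P_{X|UW} P_{Y|X} P_{V|WY}` for some conditional distributions `P_{W|U}`,
`P_{X|UW}`, `P_{V|WY}`, where the source `P_U` and the channel `P_{Y|X}` are given. -/
def Factorizes (PU : U → ℝ) (PYX : X → Y → ℝ) (J : Outcome U W X Y V → ℝ) : Prop :=
  ∃ (PW : U → W → ℝ) (PX : U → W → X → ℝ) (PV : W → Y → V → ℝ),
    (∀ u, PW u ∈ stdSimplex ℝ W) ∧ (∀ u w, PX u w ∈ stdSimplex ℝ X) ∧
    (∀ w y, PV w y ∈ stdSimplex ℝ V) ∧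
    ∀ u w x y v, J (u, w, x, y, v) = PU u * PW u w * PX u w x * PYX x y * PV w y v

/-- The dispersion of the channel `P_{Y|W}`, whose inputs are the `w` with `P_W(w) > 0`. -/
def channelDispersion (J : Outcome U W X Y V → ℝ) : ℝ :=
  dispersion (condLaw J rvW rvY) {w | 0 < law J rvW w}

/-- The constant `H(U,W) + H(U)` in front of the typicality parameter in the first rate
condition. -/
def const₁ (J : Outcome U W X Y V → ℝ) : ℝ :=
  entropy J (fun ω => (rvU ω, rvW ω)) + entropy J rvU

/-- The constant `H(U,W,X,Y,V) + H(W)` in front of the typicality parameter in the second rate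
condition. -/
def const₃ (J : Outcome U W X Y V → ℝ) : ℝ :=
  entropy J (fun ω => ω) + entropy J rvW

/-- The inner region for block length `n`, typicality parameter `ε₁` and error parameter `ε₅`, with
auxiliary alphabet `W`. The two coefficients `κ` and `B`, which may depend on the joint distribution
`J`, are those of the terms of order `log n / n` and `1 / √n`.
The target `P_{UXYV}` is the marginal of `J`, so that it has the form
`P_U P_{X|U} P_{Y|X} P_{V|UXY}`. -/
def innerRegion (PU : U → ℝ) (PYX : X → Y → ℝ) (n : ℕ) (ε₁ ε₅ : ℝ)
    (κ B : (Outcome U W X Y V → ℝ) → ℝ) : Set ((U × X × Y × V → ℝ) × ℝ) :=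
  {p | ∃ J : Outcome U W X Y V → ℝ,
    Factorizes PU PYX J ∧
    law J (fun ω => (rvU ω, rvX ω, rvY ω, rvV ω)) = p.1 ∧
    0 < ε₅ + B J / Real.sqrt n ∧ ε₅ + B J / Real.sqrt n ≤ 1 / 2 ∧
    mutualInfo J rvW rvU ≤ mutualInfo J rvW rvY -
      (const₁ J * ε₁ + κ J * (Real.logb 2 n / n)
        + gaussianQInv (ε₅ + B J / Real.sqrt n) * Real.sqrt (channelDispersion J / n)) ∧
    condMutualInfo J rvW (fun ω => (rvU ω, rvX ω, rvV ω)) rvY +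
      (const₃ J * ε₁ + κ J * (Real.logb 2 n / n)
        + gaussianQInv (ε₅ + B J / Real.sqrt n) * Real.sqrt (channelDispersion J / n)) ≤ p.2}

end Inner

end

end StrongCoord

/-! The auxiliary variable W is realised by a random codebook. Reversing P_U P_{W|U} into P_W
P_{U|W} (`Factorizes.exists_backwardKernel`), draw M·L codewords i.i.d. from the n-fold product of
P_W, indexed by the common randomness k and a message m. Given (u, k), the encoder draws m from its
posterior under a uniform prior and applies P_{X|UW}; given (y, k), the decoder draws a message from
its posterior and applies P_{V|WY}. For every codebook, `oneShot_l1_le` bounds the L¹ distance by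
three terms. Their codebook averages are small when log L exceeds n I(W;U) (soft covering of the
source), log L is below n I(W;Y) (decoding), and log ML exceeds n I(W;UXYV) (soft covering of the
target). Taking log L just below n I(W;Y) leaves n I(W;UXV|Y) for log M, by the chain rule. Chernoff
bounds show that rate margins of order √(log n / n) bring every tail down to 1/n and the total to
10/√n (`exists_code_l1Dist_le`).

These margins are paid for by the typicality terms alone: with c the smaller of c₁ and c₃, the
inequality n ε₁² ≥ A ln n gives c ε₁ ≥ g √(log n / n) for A = (g/c)²
(`Factorizes.exists_threshold`). The dispersion term enters only through its sign, since Q⁻¹ ≥ 0 on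
(0, 1/2], and the term κ log n / n only through positivity, in the degenerate case c = 0.

For fixed ε₁ the inequality n ε₁² ≥ A ln n fails for finitely many n only. There κ is chosen so
large that the first rate condition cannot hold; the inclusion is then vacuous, and κ stays bounded
in n. -/

namespace StrongCoord

noncomputable section

/-! ### Averages over i.i.d. families -/

section IidMean

variable {ι W Z : Type*} [Fintype ι] [DecidableEq ι] [Fintype W] [Fintype Z]

/-- The mean of `F c` when the entries of the family `c` are i.i.d. with distribution `p`. -/
def iidMean (p : W → ℝ) (F : (ι → W) → ℝ) : ℝ := ∑ c : ι → W, (∏ i, p (c i)) * F c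

/-- Independence in the form of the distributive law. The moments below follow by taking the factor
1 at all entries that do not occur. -/
lemma iidMean_prod (p : W → ℝ) (f : ι → W → ℝ) :
    iidMean p (fun c => ∏ i, f i (c i)) = ∏ i, ∑ w, p w * f i w := by
  simp only [iidMean, ← Finset.prod_mul_distrib, Fintype.prod_sum]

lemma iidMean_weight_sum {p : W → ℝ} (hp : ∑ w, p w = 1) :
    ∑ c : ι → W, ∏ i, p (c i) = 1 := by
  simpa [iidMean, hp] using iidMean_prod (ι := ι) p (fun _ _ => 1)

omit [DecidableEq ι] [Fintype W] in
lemma iidMean_weight_nonneg {p : W → ℝ} (hp : ∀ w, 0 ≤ p w) (c : ι → W) : 0 ≤ ∏ i, p (c i) :=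
  Finset.prod_nonneg fun _ _ => hp _

lemma iidMean_eval {p : W → ℝ} (hp : ∑ w, p w = 1) (j : ι) (f : W → ℝ) :
    iidMean p (fun c => f (c j)) = ∑ w, p w * f w := by
  have h := iidMean_prod (ι := ι) p (fun i w => if i = j then f w else 1)
  rw [Finset.prod_eq_single j (fun i _ hi => by simp [hi, hp]) (by simp)] at h
  simpa using h

lemma iidMean_eval_mul {p : W → ℝ} (hp : ∑ w, p w = 1) {j k : ι} (hjk : j ≠ k) (f g : W → ℝ) :
    iidMean p (fun c => f (c j) * g (c k)) = (∑ w, p w * f w) * ∑ w, p w * g w := by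
  have h := iidMean_prod (ι := ι) p
    (fun i w => (if i = j then f w else 1) * (if i = k then g w else 1))
  rw [← Finset.prod_subset (Finset.subset_univ {j, k}) (fun i _ hi => by
    simp only [Finset.mem_insert, Finset.mem_singleton, not_or] at hi
    simp [hi.1, hi.2, hp]), Finset.prod_pair hjk] at h
  simp only [Finset.prod_mul_distrib, Finset.prod_ite_eq', Finset.mem_univ, if_true,
    if_neg hjk, if_neg hjk.symm, one_mul, mul_one] at h
  exact h

lemma iidMean_mono {p : W → ℝ} (hp : ∀ w, 0 ≤ p w) {F G : (ι → W) → ℝ} (h : ∀ c, F c ≤ G c) :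
    iidMean p F ≤ iidMean p G :=
  Finset.sum_le_sum fun c _ => mul_le_mul_of_nonneg_left (h c) (iidMean_weight_nonneg hp c)

lemma iidMean_add (p : W → ℝ) (F G : (ι → W) → ℝ) :
    iidMean p (fun c => F c + G c) = iidMean p F + iidMean p G := by
  simp [iidMean, mul_add, Finset.sum_add_distrib]

lemma iidMean_const_mul (p : W → ℝ) (a : ℝ) (F : (ι → W) → ℝ) :
    iidMean p (fun c => a * F c) = a * iidMean p F := by
  simp only [iidMean, Finset.mul_sum]
  exact Finset.sum_congr rfl fun c _ => by ring

lemma iidMean_sum {κ : Type*} (s : Finset κ) (p : W → ℝ) (F : κ → (ι → W) → ℝ) :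
    iidMean p (fun c => ∑ k ∈ s, F k c) = ∑ k ∈ s, iidMean p (F k) := by
  simp only [iidMean, Finset.mul_sum]
  exact Finset.sum_comm

lemma iidMean_const {p : W → ℝ} (hp : ∑ w, p w = 1) (a : ℝ) :
    iidMean (ι := ι) p (fun _ => a) = a := by
  simp [iidMean, ← Finset.sum_mul, iidMean_weight_sum hp]

/-- The probabilistic method: some family has positive weight, so exceeding `a` everywhere would
push the mean strictly above `a`. -/
lemma exists_le_of_iidMean_le {p : W → ℝ} (hp : p ∈ stdSimplex ℝ W) {F : (ι → W) → ℝ} {a : ℝ}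
    (h : iidMean p F ≤ a) : ∃ c, F c ≤ a := by
  by_contra! hlt
  refine absurd h (not_le.2 ?_)
  rw [← iidMean_const (ι := ι) hp.2 a]
  obtain ⟨c, hc⟩ : ∃ c : ι → W, 0 < ∏ i, p (c i) := by
    by_contra! hc
    have := Finset.sum_nonpos (s := Finset.univ) fun c _ => hc c
    rw [iidMean_weight_sum hp.2] at this
    linarith
  exact Finset.sum_lt_sum
    (fun c _ => mul_le_mul_of_nonneg_left (hlt c).le (iidMean_weight_nonneg hp.1 c))
    ⟨c, Finset.mem_univ _, mul_lt_mul_of_pos_left (hlt c) hc⟩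

lemma iidMean_abs_le_sqrt {p : W → ℝ} (hp : p ∈ stdSimplex ℝ W) (F : (ι → W) → ℝ) :
    iidMean p (fun c => |F c|) ≤ Real.sqrt (iidMean p (fun c => F c ^ 2)) := by
  refine Real.le_sqrt_of_sq_le ?_
  have := Real.pow_arith_mean_le_arith_mean_pow_of_even Finset.univ
    (fun c : ι → W => ∏ i, p (c i)) (fun c => |F c|)
    (fun c _ => iidMean_weight_nonneg hp.1 c) (iidMean_weight_sum hp.2) even_two
  simpa [iidMean] using this

/-- The second moment of a sum of centred i.i.d. random variables. -/
lemma iidMean_sum_sq {p : W → ℝ} (hp : ∑ w, p w = 1) (S : Finset ι) {f : W → ℝ}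
    (hf : ∑ w, p w * f w = 0) :
    iidMean p (fun c => (∑ j ∈ S, f (c j)) ^ 2) = S.card * ∑ w, p w * f w ^ 2 := by
  simp only [sq, Finset.sum_mul_sum, iidMean_sum]
  rw [Finset.card_eq_sum_ones, Nat.cast_sum, Finset.sum_mul]
  refine Finset.sum_congr rfl fun j hj => ?_
  rw [Finset.sum_eq_single j]
  · rw [iidMean_eval hp j (fun w => f w * f w)]; simp
  · intro k _ hk
    rw [iidMean_eval_mul hp hk.symm, hf, zero_mul]
  · exact fun h => absurd hj h

end IidMean

/-! ### Random codebooks -/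

section Codebook

variable {ι W Z : Type*} [Fintype ι] [DecidableEq ι] [Fintype W] [Fintype Z]

open Classical in
/-- The probability that the likelihood ratio of `K` and its output law exceeds `θ`. -/
def ratioTail (p : W → ℝ) (K : W → Z → ℝ) (θ : ℝ) : ℝ :=
  ∑ w, ∑ z, if θ * outputLaw K p z < K w z then p w * K w z else 0

open Classical in
/-- The probability that the likelihood ratio of `K` and its output law is at most `θ`. -/
def ratioHead (p : W → ℝ) (K : W → Z → ℝ) (θ : ℝ) : ℝ :=
  ∑ w, ∑ z, if θ * outputLaw K p z < K w z then 0 else p w * K w z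

lemma sum_mul_sub_sq_le {p : W → ℝ} (hp : ∑ w, p w = 1) (f : W → ℝ) :
    ∑ w, p w * (f w - ∑ w', p w' * f w') ^ 2 ≤ ∑ w, p w * f w ^ 2 := by
  set m := ∑ w', p w' * f w' with hm
  have : ∑ w, p w * (f w - m) ^ 2 = ∑ w, p w * f w ^ 2 - m ^ 2 := by
    have h1 : ∀ w, p w * (f w - m) ^ 2 = p w * f w ^ 2 - 2 * m * (p w * f w) + m ^ 2 * p w :=
      fun w => by ring
    simp only [h1, Finset.sum_add_distrib, Finset.sum_sub_distrib, ← Finset.mul_sum, hp, ← hm]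
    ring
  rw [this]
  nlinarith [sq_nonneg m]

/-- Jensen reduces to the second moment, which is the variance divided by the number of samples; the
variance is at most the raw second moment. -/
lemma iidMean_abs_average_sub_le {p : W → ℝ} (hp : p ∈ stdSimplex ℝ W) {S : Finset ι}
    (hS : S.Nonempty) (f : W → ℝ) :
    iidMean p (fun c => |(1 / (S.card : ℝ)) * ∑ j ∈ S, f (c j) - ∑ w, p w * f w|) ≤
      Real.sqrt ((∑ w, p w * f w ^ 2) / S.card) := by
  have hN : (0 : ℝ) < S.card := by exact_mod_cast hS.card_pos
  refine (iidMean_abs_le_sqrt hp _).trans (Real.sqrt_le_sqrt ?_)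
  set m := ∑ w, p w * f w with hm
  have h1 : ∀ c : ι → W, ((1 / (S.card : ℝ)) * ∑ j ∈ S, f (c j) - m) ^ 2 =
      (1 / (S.card : ℝ)) ^ 2 * (∑ j ∈ S, (f (c j) - m)) ^ 2 := fun c => by
    rw [Finset.sum_sub_distrib, Finset.sum_const, nsmul_eq_mul, ← mul_pow]
    congr 1
    field_simp
  simp only [h1]
  rw [iidMean_const_mul, iidMean_sum_sq (f := fun w => f w - m) hp.2 S]
  · calc _ = (∑ w, p w * (f w - m) ^ 2) / S.card := by field_simp
      _ ≤ _ := by exact div_le_div_of_nonneg_right (sum_mul_sub_sq_le hp.2 f) hN.le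
  · simp [mul_sub, Finset.sum_sub_distrib, ← Finset.sum_mul, hp.2, hm]

/-- Only the triangle inequality, for the part of a kernel whose second moment is not controlled. -/
lemma iidMean_abs_average_sub_le_two_mul {p : W → ℝ} (hp : p ∈ stdSimplex ℝ W) {S : Finset ι}
    (hS : S.Nonempty) {f : W → ℝ} (hf : ∀ w, 0 ≤ f w) :
    iidMean p (fun c => |(1 / (S.card : ℝ)) * ∑ j ∈ S, f (c j) - ∑ w, p w * f w|) ≤
      2 * ∑ w, p w * f w := by
  have hN : (0 : ℝ) < S.card := by exact_mod_cast hS.card_pos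
  have hm : 0 ≤ ∑ w, p w * f w := Finset.sum_nonneg fun w _ => mul_nonneg (hp.1 w) (hf w)
  refine (iidMean_mono hp.1 (G := fun c => (1 / (S.card : ℝ)) * ∑ j ∈ S, f (c j) +
    ∑ w, p w * f w) fun c => ?_).trans (le_of_eq ?_)
  · have : 0 ≤ (1 / (S.card : ℝ)) * ∑ j ∈ S, f (c j) :=
      mul_nonneg (by positivity) (Finset.sum_nonneg fun j _ => hf _)
    exact abs_le.2 ⟨by linarith, by linarith⟩
  · rw [iidMean_add, iidMean_const_mul, iidMean_sum, iidMean_const hp.2]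
    simp only [iidMean_eval hp.2 _ f, Finset.sum_const, nsmul_eq_mul]
    field_simp
    ring

/-- Soft covering: the output distribution of a random codebook approximates the output
distribution of the codeword law. -/
lemma iidMean_softCovering_le {p : W → ℝ} (hp : p ∈ stdSimplex ℝ W) {K : W → Z → ℝ}
    (hK : ∀ w, K w ∈ stdSimplex ℝ Z) {S : Finset ι} (hS : S.Nonempty) {θ : ℝ} (hθ : 0 ≤ θ) :
    iidMean p (fun c => ∑ z, |(1 / (S.card : ℝ)) * ∑ j ∈ S, K (c j) z - outputLaw K p z|) ≤
      Real.sqrt (θ / S.card) + 2 * ratioTail p K θ := by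
  classical
  have hN : (0 : ℝ) < S.card := by exact_mod_cast hS.card_pos
  have hq0 : ∀ z, 0 ≤ outputLaw K p z := fun z =>
    Finset.sum_nonneg fun w _ => mul_nonneg (hp.1 w) ((hK w).1 z)
  have hq1 : ∑ z, outputLaw K p z = 1 := by
    simp only [outputLaw]
    rw [Finset.sum_comm]
    simp [← Finset.mul_sum, (hK _).2, hp.2]
  have key : ∀ z, iidMean p (fun c : ι → W =>
      |(1 / (S.card : ℝ)) * ∑ j ∈ S, K (c j) z - outputLaw K p z|) ≤
      outputLaw K p z * Real.sqrt (θ / S.card) +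
        2 * ∑ w, if θ * outputLaw K p z < K w z then p w * K w z else 0 := by
    intro z
    -- Truncation of the likelihood ratio at `θ`: `K1` has second moment at most `θ` times the
    -- squared output probability, so its average concentrates; `K2` carries the tail and is bounded
    -- by its mean.
    let K1 : W → ℝ := fun w => if θ * outputLaw K p z < K w z then 0 else K w z
    let K2 : W → ℝ := fun w => if θ * outputLaw K p z < K w z then K w z else 0
    have hK1 : ∀ w, 0 ≤ K1 w := fun w => by
      simp only [K1]; split_ifs; exacts [le_rfl, (hK w).1 z]
    have hK2 : ∀ w, 0 ≤ K2 w := fun w => by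
      simp only [K2]; split_ifs; exacts [(hK w).1 z, le_rfl]
    have hsplit : ∀ w, K w z = K1 w + K2 w := fun w => by
      simp only [K1, K2]; split_ifs <;> simp
    have hq : outputLaw K p z = ∑ w, p w * K1 w + ∑ w, p w * K2 w := by
      rw [← Finset.sum_add_distrib]
      exact Finset.sum_congr rfl fun w _ => by rw [← mul_add, ← hsplit w]
    have hsq : ∑ w, p w * K1 w ^ 2 ≤ θ * outputLaw K p z ^ 2 := by
      calc ∑ w, p w * K1 w ^ 2 ≤ ∑ w, (θ * outputLaw K p z) * (p w * K w z) := by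
            refine Finset.sum_le_sum fun w _ => ?_
            have h0 := mul_nonneg (hp.1 w) ((hK w).1 z)
            simp only [K1]
            split_ifs with h
            · simpa using mul_nonneg (mul_nonneg hθ (hq0 z)) h0
            · have := mul_le_mul_of_nonneg_right (not_lt.1 h) h0
              nlinarith
        _ = θ * outputLaw K p z ^ 2 := by
            rw [← Finset.mul_sum]; simp only [outputLaw]; ring
    calc _ ≤ iidMean p (fun c : ι → W =>
          |(1 / (S.card : ℝ)) * ∑ j ∈ S, K1 (c j) - ∑ w, p w * K1 w| +
          |(1 / (S.card : ℝ)) * ∑ j ∈ S, K2 (c j) - ∑ w, p w * K2 w|) := by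
          refine iidMean_mono hp.1 fun c => ?_
          refine le_trans (le_of_eq ?_) (abs_add_le _ _)
          rw [hq]
          rw [Finset.sum_congr rfl fun j (_ : j ∈ S) => hsplit (c j), Finset.sum_add_distrib]
          congr 1; ring
      _ ≤ Real.sqrt ((∑ w, p w * K1 w ^ 2) / S.card) + 2 * ∑ w, p w * K2 w := by
          rw [iidMean_add]
          exact add_le_add (iidMean_abs_average_sub_le hp hS K1)
            (iidMean_abs_average_sub_le_two_mul hp hS hK2)
      _ ≤ _ := by
          refine add_le_add ?_ (le_of_eq ?_)
          · calc _ ≤ Real.sqrt (outputLaw K p z ^ 2 * (θ / S.card)) := by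
                  refine Real.sqrt_le_sqrt ?_
                  rw [← mul_div_assoc]
                  exact div_le_div_of_nonneg_right (by linarith) hN.le
              _ = _ := by rw [Real.sqrt_mul (sq_nonneg _), Real.sqrt_sq (hq0 z)]
          · simp [K2, mul_ite]
  rw [iidMean_sum]
  refine (Finset.sum_le_sum fun z _ => key z).trans (le_of_eq ?_)
  rw [Finset.sum_add_distrib, ← Finset.sum_mul, hq1, one_mul, ← Finset.mul_sum, ratioTail,
    Finset.sum_comm]

/-- Normalisation of a nonnegative vector to a probability vector, with default the point mass at `z₀`. -/
def normalize [DecidableEq Z] (z₀ : Z) (a : Z → ℝ) (z : Z) : ℝ :=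
  if ∑ z', a z' = 0 then (if z = z₀ then 1 else 0) else a z / ∑ z', a z'

lemma normalize_mem [DecidableEq Z] (z₀ : Z) {a : Z → ℝ} (ha : ∀ z, 0 ≤ a z) :
    normalize z₀ a ∈ stdSimplex ℝ Z := by
  unfold normalize
  by_cases h : ∑ z', a z' = 0
  · simp only [h, if_true]
    exact ⟨fun z => by dsimp only; split_ifs <;> simp, by simp⟩
  · simp only [h, if_false]
    refine ⟨fun z => div_nonneg (ha z) (Finset.sum_nonneg fun z _ => ha z), ?_⟩
    rw [← Finset.sum_div, div_self h]

lemma normalize_mul_sum [DecidableEq Z] (z₀ : Z) {a : Z → ℝ} (ha : ∀ z, 0 ≤ a z) (z : Z) :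
    normalize z₀ a z * ∑ z', a z' = a z := by
  unfold normalize
  by_cases h : ∑ z', a z' = 0
  · rw [h, mul_zero, (Finset.sum_eq_zero_iff_of_nonneg fun z _ => ha z).1 h z (Finset.mem_univ z)]
  · simp only [h, if_false]
    rw [div_mul_cancel₀ _ h]

/-- With S the total mass, a(1 − a/S) = (a/S)(S − a) and a/S ≤ 1. This plays the role of the union
bound for a decoder that samples from the posterior. -/
lemma mul_one_sub_normalize_le [DecidableEq Z] (z₀ : Z) {a : Z → ℝ} (ha : ∀ z, 0 ≤ a z) (z : Z) :
    a z * (1 - normalize z₀ a z) ≤ ∑ z' ∈ Finset.univ.erase z, a z' := by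
  have h1 := normalize_mul_sum z₀ ha z
  have h2 := normalize_mem z₀ ha
  have h3 : normalize z₀ a z ≤ 1 := by
    rw [← h2.2]
    exact Finset.single_le_sum (fun i _ => h2.1 i) (Finset.mem_univ z)
  have h4 := Finset.add_sum_erase Finset.univ a (Finset.mem_univ z)
  have h5 : 0 ≤ ∑ z' ∈ Finset.univ.erase z, a z' := Finset.sum_nonneg fun z _ => ha z
  nlinarith [h2.1 z]

/-- The error probability of the likelihood decoder, averaged over a random codebook. -/
lemma iidMean_likelihoodDecoder_le {κ : Type*} [Fintype κ] [DecidableEq κ] {p : W → ℝ}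
    (hp : p ∈ stdSimplex ℝ W) {K : W → Z → ℝ} (hK : ∀ w, K w ∈ stdSimplex ℝ Z) {e : κ → ι}
    (he : Function.Injective e) (m₀ m : κ) {θ : ℝ} (hθ : 0 < θ) :
    iidMean p (fun c => ∑ z, K (c (e m)) z *
      (1 - normalize m₀ (fun m' => K (c (e m')) z) m)) ≤
      ratioHead p K θ + Fintype.card κ / θ := by
  classical
  have hq0 : ∀ z, 0 ≤ outputLaw K p z := fun z =>
    Finset.sum_nonneg fun w _ => mul_nonneg (hp.1 w) ((hK w).1 z)
  have hq1 : ∑ z, outputLaw K p z = 1 := by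
    simp only [outputLaw]
    rw [Finset.sum_comm]
    simp [← Finset.mul_sum, (hK _).2, hp.2]
  -- `T` marks the codewords passing the threshold test. By Markov's inequality an independent
  -- codeword passes with probability at most 1/θ; `hTq` keeps the factor `outputLaw K p z`, so that
  -- its vanishing needs no separate case.
  let T : Z → W → ℝ := fun z w => if θ * outputLaw K p z < K w z then 1 else 0
  have hT0 : ∀ z w, 0 ≤ T z w := fun z w => by simp only [T]; split_ifs <;> norm_num
  have hTq : ∀ z, (∑ w, p w * T z w) * outputLaw K p z ≤ outputLaw K p z / θ := by
    intro z
    rw [le_div_iff₀ hθ]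
    calc (∑ w, p w * T z w) * outputLaw K p z * θ
        = ∑ w, p w * (T z w * (θ * outputLaw K p z)) := by
          rw [Finset.sum_mul, Finset.sum_mul]
          exact Finset.sum_congr rfl fun w _ => by ring
      _ ≤ ∑ w, p w * K w z := by
          refine Finset.sum_le_sum fun w _ => mul_le_mul_of_nonneg_left ?_ (hp.1 w)
          simp only [T]
          split_ifs with h
          · linarith
          · simpa using (hK w).1 z
      _ = _ := rfl
  have key : ∀ z, iidMean p (fun c : ι → W => K (c (e m)) z *
      (1 - normalize m₀ (fun m' => K (c (e m')) z) m)) ≤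
      (∑ w, if θ * outputLaw K p z < K w z then 0 else p w * K w z) +
        Fintype.card κ * (outputLaw K p z / θ) := by
    intro z
    -- If the true codeword fails the test, the error is bounded by 1; if it passes, by the total
    -- likelihood of the wrong codewords, which are independent of it.
    calc _ ≤ iidMean p (fun c : ι → W => (1 - T z (c (e m))) * K (c (e m)) z +
          ∑ m' ∈ Finset.univ.erase m, T z (c (e m)) * K (c (e m')) z) := by
          refine iidMean_mono hp.1 fun c => ?_
          have h0 : ∀ m', 0 ≤ K (c (e m')) z := fun m' => (hK _).1 z
          have h1 := mul_one_sub_normalize_le m₀ h0 m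
          have h2 := (normalize_mem m₀ h0).1 m
          rw [← Finset.mul_sum]
          by_cases h : θ * outputLaw K p z < K (c (e m)) z
          · simpa only [T, h, if_true, sub_self, zero_mul, zero_add, one_mul] using h1
          · simp only [T, h, if_false, sub_zero, one_mul, zero_mul, add_zero]
            nlinarith [h0 m]
      _ = (∑ w, p w * ((1 - T z w) * K w z)) +
          ∑ m' ∈ Finset.univ.erase m, (∑ w, p w * T z w) * outputLaw K p z := by
          rw [iidMean_add, iidMean_sum, iidMean_eval hp.2 (e m) (fun w => (1 - T z w) * K w z)]
          congr 1
          refine Finset.sum_congr rfl fun m' hm' => ?_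
          have hne : e m ≠ e m' := fun h => (Finset.mem_erase.1 hm').1 (he h).symm
          rw [iidMean_eval_mul hp.2 hne (T z) (fun w => K w z)]
          rfl
      _ ≤ _ := by
          refine add_le_add (le_of_eq ?_) ?_
          · refine Finset.sum_congr rfl fun w _ => ?_
            simp only [T]
            split_ifs <;> simp
          · rw [Finset.sum_const, nsmul_eq_mul]
            refine mul_le_mul ?_ (hTq z) (mul_nonneg (Finset.sum_nonneg fun w _ =>
              mul_nonneg (hp.1 w) (hT0 z w)) (hq0 z)) (Nat.cast_nonneg _)
            exact_mod_cast Finset.card_le_univ _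
  rw [iidMean_sum]
  refine (Finset.sum_le_sum fun z _ => key z).trans (le_of_eq ?_)
  rw [Finset.sum_add_distrib, ← Finset.mul_sum, ← Finset.sum_div, hq1, ratioHead,
    Finset.sum_comm, mul_one_div]

end Codebook

/-! ### The one-shot coordination code of a codebook -/

section OneShot

variable {U W X Y V κ : Type*} [Fintype U] [Fintype X] [Fintype Y] [Fintype V]
  [Fintype κ] [DecidableEq κ]

/-- Only the mass `1 - D m` placed off `m` contributes, and two distributions are at L¹ distance at
most 2. -/
lemma sum_abs_mixture_sub_le {D : κ → ℝ} (hD : D ∈ stdSimplex ℝ κ) {Q : κ → V → ℝ}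
    (hQ : ∀ m, Q m ∈ stdSimplex ℝ V) (m : κ) :
    ∑ v, |∑ m', D m' * Q m' v - Q m v| ≤ 2 * (1 - D m) := by
  have h1 : ∀ v, |∑ m', D m' * Q m' v - Q m v| ≤ ∑ m', D m' * |Q m' v - Q m v| := fun v => by
    have : ∑ m', D m' * Q m' v - Q m v = ∑ m', D m' * (Q m' v - Q m v) := by
      simp only [mul_sub, Finset.sum_sub_distrib, ← Finset.sum_mul, hD.2, one_mul]
    rw [this]
    refine (Finset.abs_sum_le_sum_abs _ _).trans (Finset.sum_le_sum fun m' _ => ?_)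
    rw [abs_mul, abs_of_nonneg (hD.1 m')]
  refine (Finset.sum_le_sum fun v _ => h1 v).trans ?_
  rw [Finset.sum_comm]
  simp only [← Finset.mul_sum]
  rw [← Finset.add_sum_erase _ _ (Finset.mem_univ m)]
  have h2 := Finset.add_sum_erase Finset.univ D (Finset.mem_univ m)
  rw [hD.2] at h2
  have h3 : ∑ m' ∈ Finset.univ.erase m, D m' * ∑ v, |Q m' v - Q m v| ≤
      ∑ m' ∈ Finset.univ.erase m, D m' * 2 := by
    refine Finset.sum_le_sum fun m' _ => mul_le_mul_of_nonneg_left ?_ (hD.1 m')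
    calc ∑ v, |Q m' v - Q m v| ≤ ∑ v, (Q m' v + Q m v) := Finset.sum_le_sum fun v _ => by
          have := (hQ m').1 v
          have := (hQ m).1 v
          exact abs_le.2 ⟨by linarith, by linarith⟩
      _ = 2 := by rw [Finset.sum_add_distrib, (hQ m').2, (hQ m).2]; norm_num
  rw [← Finset.sum_mul] at h3
  simp only [sub_self, abs_zero, Finset.sum_const_zero, mul_zero, zero_add]
  linarith

/-- The conditional distribution of `(U, X, Y, V)` given `W`. -/
def jointKernel (K : W → U → ℝ) (PX : U → W → X → ℝ) (PYX : X → Y → ℝ) (PV : W → Y → V → ℝ)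
    (w : W) (z : U × X × Y × V) : ℝ :=
  K w z.1 * PX z.1 w z.2.1 * PYX z.2.1 z.2.2.1 * PV w z.2.2.1 z.2.2.2

/-- The conditional distribution of `Y` given `W`. -/
def relayKernel (K : W → U → ℝ) (PX : U → W → X → ℝ) (PYX : X → Y → ℝ) (w : W) (y : Y) : ℝ :=
  ∑ u, ∑ x, K w u * PX u w x * PYX x y

lemma jointKernel_mem {K : W → U → ℝ} {PX : U → W → X → ℝ} {PYX : X → Y → ℝ}
    {PV : W → Y → V → ℝ} (hK : ∀ w, K w ∈ stdSimplex ℝ U)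
    (hPX : ∀ u w, PX u w ∈ stdSimplex ℝ X) (hPYX : ∀ x, PYX x ∈ stdSimplex ℝ Y)
    (hPV : ∀ w y, PV w y ∈ stdSimplex ℝ V) (w : W) :
    jointKernel K PX PYX PV w ∈ stdSimplex ℝ (U × X × Y × V) := by
  refine ⟨fun z => mul_nonneg (mul_nonneg (mul_nonneg ((hK _).1 _) ((hPX _ _).1 _))
    ((hPYX _).1 _)) ((hPV _ _).1 _), ?_⟩
  simp only [jointKernel, Fintype.sum_prod_type, ← Finset.mul_sum, (hPV _ _).2, (hPYX _).2,
    (hPX _ _).2, (hK _).2, mul_one]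

lemma relayKernel_mem {K : W → U → ℝ} {PX : U → W → X → ℝ} {PYX : X → Y → ℝ}
    (hK : ∀ w, K w ∈ stdSimplex ℝ U)
    (hPX : ∀ u w, PX u w ∈ stdSimplex ℝ X) (hPYX : ∀ x, PYX x ∈ stdSimplex ℝ Y) (w : W) :
    relayKernel K PX PYX w ∈ stdSimplex ℝ Y := by
  refine ⟨fun y => Finset.sum_nonneg fun u _ => Finset.sum_nonneg fun x _ =>
    mul_nonneg (mul_nonneg ((hK _).1 _) ((hPX _ _).1 _)) ((hPYX _).1 _), ?_⟩
  simp only [relayKernel]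
  rw [Finset.sum_comm]
  simp only [Finset.sum_comm (s := (Finset.univ : Finset Y)), ← Finset.mul_sum, (hPYX _).2,
    (hPX _ _).2, (hK _).2, mul_one]

/-- The output of a channel whose input is a codeword drawn with the posterior distribution given
the observation `a`, for the likelihoods `K` and the codewords `c`. -/
def posteriorMap {A B : Type*} (m₀ : κ) (K : W → A → ℝ) (F : A → W → B → ℝ) (c : κ → W)
    (a : A) (b : B) : ℝ :=
  ∑ m, normalize m₀ (fun m' => K (c m') a) m * F a (c m) b

lemma posteriorMap_mem {A B : Type*} [Fintype B] (m₀ : κ) {K : W → A → ℝ} {F : A → W → B → ℝ}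
    (hK : ∀ w a, 0 ≤ K w a) (hF : ∀ a w, F a w ∈ stdSimplex ℝ B) (c : κ → W) (a : A) :
    posteriorMap m₀ K F c a ∈ stdSimplex ℝ B := by
  have h := normalize_mem m₀ (a := fun m' => K (c m') a) fun m' => hK _ _
  refine ⟨fun b => Finset.sum_nonneg fun m _ => mul_nonneg (h.1 m) ((hF _ _).1 b), ?_⟩
  simp only [posteriorMap]
  rw [Finset.sum_comm]
  simp only [← Finset.mul_sum, (hF _ _).2, mul_one, h.2]

/-- Bayes' rule: fed with the codebook output, the posterior sampler restores the exact joint law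
with the codeword, so the encoder costs nothing beyond the mismatch of the source. -/
lemma sum_mul_posteriorMap {A B : Type*} (m₀ : κ) {K : W → A → ℝ} {F : A → W → B → ℝ}
    (hK : ∀ w a, 0 ≤ K w a) (c : κ → W) (a : A) (b : B) :
    (∑ m, K (c m) a) * posteriorMap m₀ K F c a b = ∑ m, K (c m) a * F a (c m) b := by
  simp only [posteriorMap, Finset.mul_sum]
  refine Finset.sum_congr rfl fun m _ => ?_
  rw [← normalize_mul_sum m₀ (a := fun m' => K (c m') a) (fun m' => hK _ _) m]
  ring

variable {ι : Type*} [Fintype ι]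

/-- The distance between the distribution induced by the likelihood encoder and the likelihood
decoder of a codebook and a target `T` is at most the sum of three terms: the distance of the
source from the codebook output, twice the decoding error probability, and the distance of the
target from the codebook output. -/
lemma oneShot_l1_le {PU : U → ℝ} {K : W → U → ℝ} {PX : U → W → X → ℝ}
    {PYX : X → Y → ℝ} {PV : W → Y → V → ℝ} (hK : ∀ w, K w ∈ stdSimplex ℝ U)
    (hPX : ∀ u w, PX u w ∈ stdSimplex ℝ X) (hPYX : ∀ x, PYX x ∈ stdSimplex ℝ Y)
    (hPV : ∀ w y, PV w y ∈ stdSimplex ℝ V) (m₀ : κ) (c : ι × κ → W)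
    (T : U × X × Y × V → ℝ) {a b : ℝ} (ha : 0 ≤ a) (hb : 0 ≤ b) :
    ∑ u, ∑ x, ∑ y, ∑ v, |∑ k, a * (PU u * posteriorMap m₀ K PX (fun m => c (k, m)) u x * PYX x y *
        posteriorMap m₀ (relayKernel K PX PYX) (fun y w => PV w y) (fun m => c (k, m)) y v) -
        T (u, x, y, v)| ≤
      ∑ k, a * ∑ u, |b * ∑ m, K (c (k, m)) u - PU u| +
      2 * ∑ k, ∑ m, a * b * ∑ y, relayKernel K PX PYX (c (k, m)) y *
        (1 - normalize m₀ (fun m' => relayKernel K PX PYX (c (k, m')) y) m) +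
      ∑ z, |a * b * ∑ j, jointKernel K PX PYX PV (c j) z - T z| := by
  have hR := relayKernel_mem hK hPX hPYX
  set R := relayKernel K PX PYX with hRdef
  set E : ι → U → X → ℝ := fun k => posteriorMap m₀ K PX (fun m => c (k, m))
  set D : ι → Y → V → ℝ := fun k => posteriorMap m₀ R (fun y w => PV w y) (fun m => c (k, m))
   
  have hE : ∀ k u, E k u ∈ stdSimplex ℝ X := fun k u =>
    posteriorMap_mem m₀ (fun w => (hK w).1) hPX _ u
  have hD : ∀ k y, D k y ∈ stdSimplex ℝ V := fun k y =>
    posteriorMap_mem m₀ (fun w => (hR w).1) (fun y w => hPV w y) _ y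
  have hEsum : ∀ k u x, (∑ m, K (c (k, m)) u) * E k u x =
      ∑ m, K (c (k, m)) u * PX u (c (k, m)) x := fun k u x =>
    sum_mul_posteriorMap m₀ (fun w => (hK w).1) _ u x
  have hpt : ∀ u x y v, |∑ k, a * (PU u * E k u x * PYX x y * D k y v) - T (u, x, y, v)| ≤
      ∑ k, a * (|b * ∑ m, K (c (k, m)) u - PU u| * E k u x * PYX x y * D k y v) +
      ∑ k, ∑ m, a * b * (K (c (k, m)) u * PX u (c (k, m)) x * PYX x y *
        |D k y v - PV (c (k, m)) y v|) +
      |a * b * ∑ j, jointKernel K PX PYX PV (c j) (u, x, y, v) - T (u, x, y, v)| := by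
    intro u x y v
    -- Telescoping: first the source is replaced by the codebook output, then the decoder by the
    -- channel `PV` applied to the true codeword; what remains is the joint codebook output minus
    -- the target.
    have hsplit : ∑ k, a * (PU u * E k u x * PYX x y * D k y v) - T (u, x, y, v) =
        -(∑ k, a * ((b * ∑ m, K (c (k, m)) u - PU u) * E k u x * PYX x y * D k y v)) +
        ∑ k, ∑ m, a * b * (K (c (k, m)) u * PX u (c (k, m)) x * PYX x y *
          (D k y v - PV (c (k, m)) y v)) +
        (a * b * ∑ j, jointKernel K PX PYX PV (c j) (u, x, y, v) - T (u, x, y, v)) := by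
      rw [Fintype.sum_prod_type]
      simp only [jointKernel, Finset.mul_sum (s := (Finset.univ : Finset ι))]
      rw [← add_sub_assoc, ← Finset.sum_neg_distrib, ← Finset.sum_add_distrib,
        ← Finset.sum_add_distrib]
      congr 1
      refine Finset.sum_congr rfl fun k _ => ?_
      have h1 : ∑ m, a * b * (K (c (k, m)) u * PX u (c (k, m)) x * PYX x y *
          (D k y v - PV (c (k, m)) y v)) = a * b * ((∑ m, K (c (k, m)) u * PX u (c (k, m)) x) *
          PYX x y * D k y v) - a * b * ∑ m, K (c (k, m)) u * PX u (c (k, m)) x * PYX x y *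
          PV (c (k, m)) y v := by
        simp only [Finset.sum_mul, Finset.mul_sum]
        rw [← Finset.sum_sub_distrib]
        exact Finset.sum_congr rfl fun m _ => by ring
      rw [h1, ← hEsum]
      ring
    rw [hsplit]
    refine (abs_add_three _ _ _).trans (add_le_add (add_le_add ?_ ?_) le_rfl)
    · rw [abs_neg]
      refine (Finset.abs_sum_le_sum_abs _ _).trans (Finset.sum_le_sum fun k _ => le_of_eq ?_)
      rw [abs_mul, abs_mul, abs_mul, abs_mul, abs_of_nonneg ha, abs_of_nonneg ((hE k u).1 x),
        abs_of_nonneg ((hPYX x).1 y), abs_of_nonneg ((hD k y).1 v)]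
    · refine (Finset.abs_sum_le_sum_abs _ _).trans (Finset.sum_le_sum fun k _ => ?_)
      refine (Finset.abs_sum_le_sum_abs _ _).trans (Finset.sum_le_sum fun m _ => le_of_eq ?_)
      rw [abs_mul, abs_mul, abs_mul, abs_mul, abs_mul, abs_of_nonneg ha, abs_of_nonneg hb,
        abs_of_nonneg ((hK _).1 u), abs_of_nonneg ((hPYX x).1 y), abs_of_nonneg ((hPX _ _).1 x)]
  refine (Finset.sum_le_sum fun u _ => Finset.sum_le_sum fun x _ => Finset.sum_le_sum fun y _ =>
    Finset.sum_le_sum fun v _ => hpt u x y v).trans ?_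
  simp only [Finset.sum_add_distrib]
  refine add_le_add (add_le_add (le_of_eq ?_) ?_) (le_of_eq ?_)
  · have h1 : ∀ u x y, ∑ v, ∑ k, a * (|b * ∑ m, K (c (k, m)) u - PU u| * E k u x * PYX x y *
        D k y v) = ∑ k, a * (|b * ∑ m, K (c (k, m)) u - PU u| * E k u x * PYX x y) := by
      intro u x y
      rw [Finset.sum_comm]
      simp only [← Finset.mul_sum, (hD _ _).2, mul_one]
    have h2 : ∀ u, ∑ x, ∑ y, ∑ k, a * (|b * ∑ m, K (c (k, m)) u - PU u| * E k u x * PYX x y) =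
        ∑ k, a * |b * ∑ m, K (c (k, m)) u - PU u| := by
      intro u
      simp only [Finset.sum_comm (t := (Finset.univ : Finset ι)), ← Finset.mul_sum, (hPYX _).2,
        (hE _ _).2, mul_one]
    simp only [h1, h2]
    rw [Finset.sum_comm]
    simp only [Finset.mul_sum]
  · have h1 : ∀ k m y, ∑ v, |D k y v - PV (c (k, m)) y v| ≤
        2 * (1 - normalize m₀ (fun m' => R (c (k, m')) y) m) := fun k m y =>
      sum_abs_mixture_sub_le (normalize_mem m₀ fun m' => (hR _).1 y)
        (fun m' => hPV (c (k, m')) y) m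
    calc _ = ∑ k, ∑ m, a * b * ∑ y, R (c (k, m)) y * ∑ v, |D k y v - PV (c (k, m)) y v| := by
          simp only [Finset.sum_comm (t := (Finset.univ : Finset ι))]
          refine Finset.sum_congr rfl fun k _ => ?_
          simp only [Finset.sum_comm (t := (Finset.univ : Finset κ))]
          refine Finset.sum_congr rfl fun m _ => ?_
          simp only [← Finset.mul_sum]
          congr 1
          simp only [hRdef, relayKernel, Finset.sum_mul]
          simp only [Finset.sum_comm (s := (Finset.univ : Finset Y))]
      _ ≤ ∑ k, ∑ m, a * b * ∑ y, R (c (k, m)) y *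
            (2 * (1 - normalize m₀ (fun m' => R (c (k, m')) y) m)) := by
          refine Finset.sum_le_sum fun k _ => Finset.sum_le_sum fun m _ =>
            mul_le_mul_of_nonneg_left (Finset.sum_le_sum fun y _ =>
              mul_le_mul_of_nonneg_left (h1 k m y) ((hR _).1 y)) (mul_nonneg ha hb)
      _ = _ := by
          simp only [Finset.mul_sum]
          exact Finset.sum_congr rfl fun k _ => Finset.sum_congr rfl fun m _ =>
            Finset.sum_congr rfl fun y _ => by ring
  · simp only [Fintype.sum_prod_type]

end OneShot

/-! ### Averaging the one-shot bound over the codebook -/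

section OneShotExistence

variable {U W X Y V : Type*} [Fintype U] [Fintype W] [Fintype X] [Fintype Y] [Fintype V]

/-- Some codebook attains the averages of the three error terms of the one-shot code. -/
lemma exists_codebook_l1_le {M L : ℕ} (hM : 0 < M) (m₀ : Fin L) {p : W → ℝ}
    (hp : p ∈ stdSimplex ℝ W) {K : W → U → ℝ} {PX : U → W → X → ℝ}
    {PYX : X → Y → ℝ} {PV : W → Y → V → ℝ} (hK : ∀ w, K w ∈ stdSimplex ℝ U)
    (hPX : ∀ u w, PX u w ∈ stdSimplex ℝ X) (hPYX : ∀ x, PYX x ∈ stdSimplex ℝ Y)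
    (hPV : ∀ w y, PV w y ∈ stdSimplex ℝ V) {θ₁ θ₂ θ₃ : ℝ} (h₁ : 0 ≤ θ₁) (h₂ : 0 < θ₂)
    (h₃ : 0 ≤ θ₃) :
    ∃ c : Fin M × Fin L → W,
    ∑ u, ∑ x, ∑ y, ∑ v, |∑ k, 1 / (M : ℝ) * (outputLaw K p u *
        posteriorMap m₀ K PX (fun m => c (k, m)) u x * PYX x y *
        posteriorMap m₀ (relayKernel K PX PYX) (fun y w => PV w y) (fun m => c (k, m)) y v) -
        outputLaw (jointKernel K PX PYX PV) p (u, x, y, v)| ≤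
      (Real.sqrt (θ₁ / L) + 2 * ratioTail p K θ₁) +
      2 * (ratioHead p (relayKernel K PX PYX) θ₂ + L / θ₂) +
      (Real.sqrt (θ₃ / (M * L)) + 2 * ratioTail p (jointKernel K PX PYX PV) θ₃) := by
  have hM' : (0 : ℝ) < M := by exact_mod_cast hM
  have hL : 0 < L := m₀.pos
  have hL' : (0 : ℝ) < L := by exact_mod_cast hL
  have hR := relayKernel_mem hK hPX hPYX
  have hJ := jointKernel_mem hK hPX hPYX hPV
  suffices h : iidMean p (fun c : Fin M × Fin L → W =>
      ∑ k, 1 / (M : ℝ) * ∑ u, |1 / (L : ℝ) * ∑ m, K (c (k, m)) u - outputLaw K p u| +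
      2 * ∑ k, ∑ m, 1 / (M : ℝ) * (1 / (L : ℝ)) * ∑ y, relayKernel K PX PYX (c (k, m)) y *
        (1 - normalize m₀ (fun m' => relayKernel K PX PYX (c (k, m')) y) m) +
      ∑ z, |1 / (M : ℝ) * (1 / (L : ℝ)) * ∑ j, jointKernel K PX PYX PV (c j) z -
        outputLaw (jointKernel K PX PYX PV) p z|) ≤
      (Real.sqrt (θ₁ / L) + 2 * ratioTail p K θ₁) +
      2 * (ratioHead p (relayKernel K PX PYX) θ₂ + L / θ₂) +
      (Real.sqrt (θ₃ / (M * L)) + 2 * ratioTail p (jointKernel K PX PYX PV) θ₃) by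
    obtain ⟨c, hc⟩ := exists_le_of_iidMean_le hp h
    refine ⟨c, ?_⟩
    have h1 := oneShot_l1_le (PU := outputLaw K p) hK hPX hPYX hPV m₀ c
      (outputLaw (jointKernel K PX PYX PV) p)
      (one_div_nonneg.2 hM'.le) (one_div_nonneg.2 hL'.le)
    exact h1.trans hc
  rw [iidMean_add, iidMean_add, iidMean_const_mul, iidMean_sum, iidMean_sum]
  refine add_le_add (add_le_add ?_ (mul_le_mul_of_nonneg_left ?_ zero_le_two)) ?_
  · refine (Finset.sum_le_sum (g := fun _ => 1 / (M : ℝ) *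
      (Real.sqrt (θ₁ / L) + 2 * ratioTail p K θ₁)) fun k _ => ?_).trans (le_of_eq ?_)
    · rw [iidMean_const_mul]
      refine mul_le_mul_of_nonneg_left ?_ (by positivity)
      -- For each value `k` of the common randomness, the source is covered by the `L` codewords of
      -- row `k` alone.
      have := iidMean_softCovering_le hp hK (ι := Fin M × Fin L)
        (S := Finset.univ.map ⟨fun m : Fin L => (k, m), fun m m' h => (Prod.mk.inj h).2⟩)
        (by
          have : Nonempty (Fin L) := ⟨⟨0, hL⟩⟩
          exact Finset.univ_nonempty.map) h₁
      simpa only [Finset.sum_map, Finset.card_map, Finset.card_univ, Fintype.card_fin] using! this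
    · rw [Finset.sum_const, nsmul_eq_mul, Finset.card_univ, Fintype.card_fin]
      field_simp
  · refine (Finset.sum_le_sum (g := fun _ => 1 / (M : ℝ) *
      (ratioHead p (relayKernel K PX PYX) θ₂ + L / θ₂)) fun k _ => ?_).trans (le_of_eq ?_)
    · rw [iidMean_sum]
      refine (Finset.sum_le_sum (g := fun _ => 1 / (M : ℝ) * (1 / (L : ℝ)) *
        (ratioHead p (relayKernel K PX PYX) θ₂ + L / θ₂)) fun m _ => ?_).trans (le_of_eq ?_)
      · rw [iidMean_const_mul]
        refine mul_le_mul_of_nonneg_left ?_ (by positivity)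
        have := iidMean_likelihoodDecoder_le hp hR (ι := Fin M × Fin L)
          (e := fun m : Fin L => (k, m)) (fun m m' h => (Prod.mk.inj h).2) m₀ m h₂
        simpa using this
      · rw [Finset.sum_const, nsmul_eq_mul, Finset.card_univ, Fintype.card_fin]
        field_simp
    · rw [Finset.sum_const, nsmul_eq_mul, Finset.card_univ, Fintype.card_fin]
      field_simp
  · have := iidMean_softCovering_le hp hJ (ι := Fin M × Fin L) (S := Finset.univ)
      (by
        have : Nonempty (Fin M × Fin L) := ⟨(⟨0, hM⟩, ⟨0, hL⟩)⟩
        exact Finset.univ_nonempty) h₃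
    simpa [mul_comm] using this

end OneShotExistence

/-! ### Product distributions -/

section Product

variable {n : ℕ} {U W X Y V Z : Type*} [Fintype U] [Fintype W] [Fintype X] [Fintype Y] [Fintype V]
  [Fintype Z]

/-- The `n`-fold product of a distribution. -/
def powLaw (n : ℕ) (p : W → ℝ) (w : Fin n → W) : ℝ := ∏ i, p (w i)

/-- The `n`-fold product of a channel. -/
def powKernel (n : ℕ) (K : W → Z → ℝ) (w : Fin n → W) (z : Fin n → Z) : ℝ := ∏ i, K (w i) (z i)

/-- The `n`-fold product of a conditional distribution given two variables. -/
def powCond {A B C : Type*} (n : ℕ) (F : A → B → C → ℝ) (a : Fin n → A) (b : Fin n → B)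
    (c : Fin n → C) : ℝ := ∏ i, F (a i) (b i) (c i)

lemma powCond_mem {A B C : Type*} [Fintype C] {F : A → B → C → ℝ}
    (hF : ∀ a b, F a b ∈ stdSimplex ℝ C) (a : Fin n → A) (b : Fin n → B) :
    powCond n F a b ∈ stdSimplex ℝ (Fin n → C) :=
  ⟨fun _ => Finset.prod_nonneg fun _ _ => (hF _ _).1 _, by
    simp only [powCond]; rw [← Fintype.prod_sum]; simp [(hF _ _).2]⟩

lemma powLaw_mem {p : W → ℝ} (hp : p ∈ stdSimplex ℝ W) :
    powLaw n p ∈ stdSimplex ℝ (Fin n → W) :=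
  ⟨fun _ => Finset.prod_nonneg fun _ _ => hp.1 _, by
    simp only [powLaw]; rw [← Fintype.prod_sum]; simp [hp.2]⟩

omit [Fintype W] in
lemma sum_powKernel (K : W → Z → ℝ) (w : Fin n → W) :
    ∑ z, powKernel n K w z = ∏ i, ∑ z, K (w i) z := by
  simp only [powKernel]; rw [← Fintype.prod_sum]

omit [Fintype W] in
lemma powKernel_mem {K : W → Z → ℝ} (hK : ∀ w, K w ∈ stdSimplex ℝ Z) (w : Fin n → W) :
    powKernel n K w ∈ stdSimplex ℝ (Fin n → Z) :=
  ⟨fun _ => Finset.prod_nonneg fun _ _ => (hK _).1 _, by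
    rw [sum_powKernel]; simp [(hK _).2]⟩

omit [Fintype Z] in
lemma outputLaw_pow (p : W → ℝ) (K : W → Z → ℝ) (z : Fin n → Z) :
    outputLaw (powKernel n K) (powLaw n p) z = ∏ i, outputLaw K p (z i) := by
  simp only [outputLaw, powKernel, powLaw, ← Finset.prod_mul_distrib, Fintype.prod_sum]

lemma sum_sum_pow (f : W → Z → ℝ) :
    ∑ w : Fin n → W, ∑ z : Fin n → Z, ∏ i, f (w i) (z i) = (∑ w, ∑ z, f w z) ^ n := by
  have h : ∀ w : Fin n → W, ∑ z : Fin n → Z, ∏ i, f (w i) (z i) = ∏ i, ∑ z, f (w i) z :=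
    fun w => (Fintype.prod_sum fun i z => f (w i) z).symm
  simp only [h]
  rw [← Fintype.prod_sum (fun (_ : Fin n) w => ∑ z, f w z)]
  simp

omit [Fintype W] [Fintype Y] in
lemma relayKernel_pow (K : W → U → ℝ) (PX : U → W → X → ℝ) (PYX : X → Y → ℝ) :
    relayKernel (powKernel n K) (powCond n PX) (powKernel n PYX) =
      powKernel n (relayKernel K PX PYX) := by
  funext w y
  simp only [relayKernel, powKernel, powCond, Fintype.prod_sum, ← Finset.prod_mul_distrib]

lemma ratioTail_comp_equiv {Z' : Type*} [Fintype Z'] (e : Z' ≃ Z) (p : W → ℝ) (K : W → Z → ℝ)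
    (θ : ℝ) : ratioTail p (fun w z => K w (e z)) θ = ratioTail p K θ := by
  classical
  simp only [ratioTail]
  refine Finset.sum_congr rfl fun w _ => ?_
  exact e.sum_comp (fun z => if θ * outputLaw K p z < K w z then p w * K w z else 0)

/-- The equivalence of words over a product alphabet with tuples of words. -/
def arrowProdEquiv (n : ℕ) (U X Y V : Type*) :
    (Fin n → U × X × Y × V) ≃ (Fin n → U) × (Fin n → X) × (Fin n → Y) × (Fin n → V) where
  toFun z := (fun i => (z i).1, fun i => (z i).2.1, fun i => (z i).2.2.1, fun i => (z i).2.2.2)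
  invFun t := fun i => (t.1 i, t.2.1 i, t.2.2.1 i, t.2.2.2 i)
  left_inv _ := rfl
  right_inv _ := rfl

omit [Fintype U] [Fintype W] [Fintype X] [Fintype Y] [Fintype V] in
lemma jointKernel_pow (K : W → U → ℝ) (PX : U → W → X → ℝ) (PYX : X → Y → ℝ)
    (PV : W → Y → V → ℝ) (w : Fin n → W) (z : Fin n → U × X × Y × V) :
    jointKernel (powKernel n K) (powCond n PX) (powKernel n PYX)
      (powCond n PV) w (arrowProdEquiv n U X Y V z) =
      powKernel n (jointKernel K PX PYX PV) w z := by
  simp only [jointKernel, powKernel, powCond, ← Finset.prod_mul_distrib]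
  rfl

lemma ratioTail_jointKernel_pow (p : W → ℝ) (K : W → U → ℝ) (PX : U → W → X → ℝ)
    (PYX : X → Y → ℝ) (PV : W → Y → V → ℝ) (θ : ℝ) :
    ratioTail (powLaw n p) (jointKernel (powKernel n K) (powCond n PX)
      (powKernel n PYX) (powCond n PV)) θ =
      ratioTail (powLaw n p) (powKernel n (jointKernel K PX PYX PV)) θ := by
  rw [← ratioTail_comp_equiv (arrowProdEquiv n U X Y V)]
  simp only [jointKernel_pow]

omit [Fintype U] [Fintype X] [Fintype Y] [Fintype V] in
lemma outputLaw_jointKernel_pow (p : W → ℝ) (K : W → U → ℝ) (PX : U → W → X → ℝ)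
    (PYX : X → Y → ℝ) (PV : W → Y → V → ℝ) (u : Fin n → U) (x : Fin n → X) (y : Fin n → Y)
    (v : Fin n → V) :
    outputLaw (jointKernel (powKernel n K) (powCond n PX)
      (powKernel n PYX) (powCond n PV)) (powLaw n p) (u, x, y, v) =
      ∏ i, outputLaw (jointKernel K PX PYX PV) p (u i, x i, y i, v i) := by
  rw [← outputLaw_pow p (jointKernel K PX PYX PV) (fun i => (u i, x i, y i, v i))]
  simp only [outputLaw, ← jointKernel_pow]
  rfl

end Product

/-! ### Exponential bounds -/

section Chernoff

variable {n : ℕ} {Ω W Z : Type*} [Fintype Ω] [Fintype W] [Fintype Z]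

/-- The bound e^t ≤ 1 + t + t² for |t| ≤ 1, applied to the centred variable; the scale `σ` keeps the
exponent in this range for all `r` in [0, 1]. -/
lemma exists_expMoment_le {P : Ω → ℝ} (hP : P ∈ stdSimplex ℝ Ω) (f : Ω → ℝ) :
    ∃ σ > 0, σ ≤ 1 ∧ ∀ r, 0 ≤ r → r ≤ 1 →
      ∑ ω, P ω * Real.exp (σ * r * f ω) ≤ Real.exp (σ * r * ∑ ω, P ω * f ω + r ^ 2) := by
  set μ := ∑ ω, P ω * f ω with hμ
  set b := ∑ ω, |f ω - μ| with hb
  have hb0 : 0 ≤ b := Finset.sum_nonneg fun _ _ => abs_nonneg _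
  have hfb : ∀ ω, |f ω - μ| ≤ b := fun ω =>
    Finset.single_le_sum (f := fun ω => |f ω - μ|) (fun _ _ => abs_nonneg _) (Finset.mem_univ ω)
  refine ⟨1 / (1 + b), by positivity, ?_, fun r hr0 hr1 => ?_⟩
  · rw [div_le_one (by positivity)]; linarith
  set σ := 1 / (1 + b) with hσ
  have hσ0 : 0 ≤ σ := by positivity
  have hpt : ∀ ω, Real.exp (σ * r * (f ω - μ)) ≤ 1 + σ * r * (f ω - μ) + r ^ 2 := by
    intro ω
    have h1 : |σ * (f ω - μ)| ≤ 1 := by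
      rw [abs_mul, abs_of_nonneg hσ0, hσ, one_div, inv_mul_le_one₀ (by positivity)]
      linarith [hfb ω]
    have h2 : |σ * r * (f ω - μ)| ≤ r := by
      rw [show σ * r * (f ω - μ) = r * (σ * (f ω - μ)) by ring, abs_mul, abs_of_nonneg hr0]
      exact mul_le_of_le_one_right hr0 h1
    have h3 := (abs_le.1 (Real.abs_exp_sub_one_sub_id_le (h2.trans hr1))).2
    have h4 : (σ * r * (f ω - μ)) ^ 2 ≤ r ^ 2 := by
      rw [← sq_abs]; exact pow_le_pow_left₀ (abs_nonneg _) h2 2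
    linarith
  have hmean : ∑ ω, P ω * (f ω - μ) = 0 := by
    simp [mul_sub, Finset.sum_sub_distrib, ← Finset.sum_mul, hP.2, hμ]
  calc ∑ ω, P ω * Real.exp (σ * r * f ω)
      = Real.exp (σ * r * μ) * ∑ ω, P ω * Real.exp (σ * r * (f ω - μ)) := by
        rw [Finset.mul_sum]
        refine Finset.sum_congr rfl fun ω _ => ?_
        rw [mul_left_comm, ← Real.exp_add]
        congr 2; ring
    _ ≤ Real.exp (σ * r * μ) * ∑ ω, P ω * (1 + σ * r * (f ω - μ) + r ^ 2) := by
        gcongr with ω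
        · exact hP.1 ω
        · exact hpt ω
    _ = Real.exp (σ * r * μ) * (r ^ 2 + 1) := by
        congr 1
        have : ∀ ω, P ω * (1 + σ * r * (f ω - μ) + r ^ 2) =
            (r ^ 2 + 1) * P ω + σ * r * (P ω * (f ω - μ)) := fun ω => by ring
        simp only [this, Finset.sum_add_distrib, ← Finset.mul_sum, hP.2, hmean]
        ring
    _ ≤ Real.exp (σ * r * μ) * Real.exp (r ^ 2) := by
        gcongr; exact Real.add_one_le_exp _
    _ = _ := by rw [← Real.exp_add]

/-- The mutual information, in nats, of the input and the output of `K` for the input law `p`. -/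
def natInfo (p : W → ℝ) (K : W → Z → ℝ) : ℝ :=
  ∑ w, ∑ z, p w * K w z * Real.log (K w z / outputLaw K p z)

/-- The sign `a` is 1 for the upper tail of the information density and −1 for the lower one. -/
lemma exists_tilted_sum_le {p : W → ℝ} (hp : p ∈ stdSimplex ℝ W) {K : W → Z → ℝ}
    (hK : ∀ w, K w ∈ stdSimplex ℝ Z) (a : ℝ) :
    ∃ σ > 0, σ ≤ 1 ∧ ∀ r, 0 ≤ r → r ≤ 1 →
      ∑ w, ∑ z, p w * K w z * Real.exp (σ * r * (a * Real.log (K w z / outputLaw K p z))) ≤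
        Real.exp (σ * r * (a * natInfo p K) + r ^ 2) := by
  have hP : (fun ω : W × Z => p ω.1 * K ω.1 ω.2) ∈ stdSimplex ℝ (W × Z) := by
    refine ⟨fun ω => mul_nonneg (hp.1 _) ((hK _).1 _), ?_⟩
    simp [Fintype.sum_prod_type, ← Finset.mul_sum, (hK _).2, hp.2]
  obtain ⟨σ, h0, h1, h⟩ := exists_expMoment_le hP
    (fun ω => a * Real.log (K ω.1 ω.2 / outputLaw K p ω.2))
  refine ⟨σ, h0, h1, fun r hr0 hr1 => ?_⟩
  have := h r hr0 hr1
  simp only [Fintype.sum_prod_type] at this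
  refine this.trans (le_of_eq ?_)
  simp only [natInfo, Finset.mul_sum]
  congr 2
  refine Finset.sum_congr rfl fun w _ => Finset.sum_congr rfl fun z _ => by ring

/-- On the support of the joint law, the logarithm of the likelihood ratio of a product channel is
the sum of the logarithms of the single-letter ratios. -/
lemma log_ratio_pow {p : W → ℝ} (hp : p ∈ stdSimplex ℝ W) {K : W → Z → ℝ}
    (hK : ∀ w, K w ∈ stdSimplex ℝ Z) {w : Fin n → W} {z : Fin n → Z}
    (h : powLaw n p w * powKernel n K w z ≠ 0) :
    0 < powKernel n K w z ∧ 0 < outputLaw (powKernel n K) (powLaw n p) z ∧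
    Real.log (powKernel n K w z) - Real.log (outputLaw (powKernel n K) (powLaw n p) z) =
      ∑ i, Real.log (K (w i) (z i) / outputLaw K p (z i)) := by
  obtain ⟨h1, h2⟩ := mul_ne_zero_iff.1 h
  have hp0 : ∀ i, 0 < p (w i) := fun i =>
    lt_of_le_of_ne (hp.1 _) (Ne.symm (Finset.prod_ne_zero_iff.1 h1 i (Finset.mem_univ i)))
  have hK0 : ∀ i, 0 < K (w i) (z i) := fun i =>
    lt_of_le_of_ne ((hK _).1 _) (Ne.symm (Finset.prod_ne_zero_iff.1 h2 i (Finset.mem_univ i)))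
  have hq0 : ∀ i, 0 < outputLaw K p (z i) := fun i =>
    lt_of_lt_of_le (mul_pos (hp0 i) (hK0 i)) (Finset.single_le_sum
      (f := fun w => p w * K w (z i)) (fun w _ => mul_nonneg (hp.1 w) ((hK w).1 _))
      (Finset.mem_univ (w i)))
  rw [outputLaw_pow]
  refine ⟨Finset.prod_pos fun i _ => hK0 i, Finset.prod_pos fun i _ => hq0 i, ?_⟩
  rw [powKernel, Real.log_prod (fun i _ => (hK0 i).ne'), Real.log_prod (fun i _ => (hq0 i).ne'),
    ← Finset.sum_sub_distrib]
  exact Finset.sum_congr rfl fun i _ => (Real.log_div (hK0 i).ne' (hq0 i).ne').symm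

lemma sum_tilted_pow (p : W → ℝ) (K : W → Z → ℝ) (f : W → Z → ℝ) (s t : ℝ) :
    ∑ w : Fin n → W, ∑ z : Fin n → Z, powLaw n p w * powKernel n K w z *
      Real.exp (s * ∑ i, f (w i) (z i) + t) =
      Real.exp t * (∑ w, ∑ z, p w * K w z * Real.exp (s * f w z)) ^ n := by
  rw [← sum_sum_pow, Finset.mul_sum]
  refine Finset.sum_congr rfl fun w _ => ?_
  rw [Finset.mul_sum]
  refine Finset.sum_congr rfl fun z _ => ?_
  rw [Real.exp_add, Finset.mul_sum, Real.exp_sum, powLaw, powKernel, Finset.prod_mul_distrib,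
    Finset.prod_mul_distrib]
  ring

/-- Chernoff's bound: on the event the exponential is at least 1, and its mean is an n-th power.
Points where a logarithm would have a junk value carry no mass. -/
lemma ratioTail_pow_le {p : W → ℝ} (hp : p ∈ stdSimplex ℝ W) {K : W → Z → ℝ}
    (hK : ∀ w, K w ∈ stdSimplex ℝ Z) {θ s : ℝ} (hθ : 0 < θ) (hs : 0 ≤ s) :
    ratioTail (powLaw n p) (powKernel n K) θ ≤ Real.exp (-(s * Real.log θ)) *
      (∑ w, ∑ z, p w * K w z * Real.exp (s * Real.log (K w z / outputLaw K p z))) ^ n := by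
  classical
  rw [← sum_tilted_pow, ratioTail]
  refine Finset.sum_le_sum fun w _ => Finset.sum_le_sum fun z _ => ?_
  have h0 : 0 ≤ powLaw n p w * powKernel n K w z :=
    mul_nonneg ((powLaw_mem hp).1 _) ((powKernel_mem hK _).1 _)
  split_ifs with h
  · rcases eq_or_ne (powLaw n p w * powKernel n K w z) 0 with h1 | h1
    · rw [h1, zero_mul]
    · obtain ⟨hk, hq, hl⟩ := log_ratio_pow hp hK h1
      refine le_mul_of_one_le_right h0 (Real.one_le_exp ?_)
      have := Real.log_le_log (mul_pos hθ hq) h.le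
      rw [Real.log_mul hθ.ne' hq.ne'] at this
      rw [← hl]
      nlinarith
  · exact mul_nonneg h0 (Real.exp_nonneg _)

lemma ratioHead_pow_le {p : W → ℝ} (hp : p ∈ stdSimplex ℝ W) {K : W → Z → ℝ}
    (hK : ∀ w, K w ∈ stdSimplex ℝ Z) {θ s : ℝ} (hθ : 0 < θ) (hs : 0 ≤ s) :
    ratioHead (powLaw n p) (powKernel n K) θ ≤ Real.exp (s * Real.log θ) *
      (∑ w, ∑ z, p w * K w z * Real.exp (s * (-1 * Real.log (K w z / outputLaw K p z)))) ^ n := by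
  classical
  rw [← sum_tilted_pow, ratioHead]
  refine Finset.sum_le_sum fun w _ => Finset.sum_le_sum fun z _ => ?_
  have h0 : 0 ≤ powLaw n p w * powKernel n K w z :=
    mul_nonneg ((powLaw_mem hp).1 _) ((powKernel_mem hK _).1 _)
  split_ifs with h
  · exact mul_nonneg h0 (Real.exp_nonneg _)
  · rcases eq_or_ne (powLaw n p w * powKernel n K w z) 0 with h1 | h1
    · rw [h1, zero_mul]
    · obtain ⟨hk, hq, hl⟩ := log_ratio_pow hp hK h1
      refine le_mul_of_one_le_right h0 (Real.one_le_exp ?_)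
      have := Real.log_le_log hk (not_lt.1 h)
      rw [Real.log_mul hθ.ne' hq.ne'] at this
      rw [← Finset.mul_sum, ← hl]
      nlinarith

/-- The order `√(log n / n)` of the deviations. -/
def devScale (n : ℕ) : ℝ := Real.sqrt (Real.log n / n)

lemma devScale_nonneg (n : ℕ) : 0 ≤ devScale n := Real.sqrt_nonneg _

lemma natCast_mul_devScale_sq (hn : 1 ≤ n) : (n : ℝ) * devScale n ^ 2 = Real.log n := by
  have : (0 : ℝ) < n := by exact_mod_cast hn
  rw [devScale, Real.sq_sqrt (div_nonneg (Real.log_natCast_nonneg n) this.le)]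
  field_simp

lemma devScale_le_one (n : ℕ) : devScale n ≤ 1 := by
  refine Real.sqrt_le_one.2 ?_
  rcases Nat.eq_zero_or_pos n with rfl | hn
  · simp
  · have : (0 : ℝ) < n := by exact_mod_cast hn
    rw [div_le_one this]
    linarith [Real.log_le_sub_one_of_pos this]

/-- The exponent of the deviation bounds. -/
lemma exp_deviation_le (hn : 2 ≤ n) {σ g d : ℝ} (hσ : 0 < σ) (hσ1 : σ ≤ 1) (hg : 5 / σ ≤ g)
    (hd : d ≤ Real.log (2 * n) - g * (n * devScale n)) :
    Real.exp (σ * devScale n * d + n * devScale n ^ 2) ≤ 1 / n := by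
  have hn0 : (0 : ℝ) < n := by positivity
  have hlog2 : Real.log (2 * n) ≤ 2 * Real.log n := by
    rw [Real.log_mul two_ne_zero hn0.ne']
    have : Real.log 2 ≤ Real.log n := Real.log_le_log two_pos (by exact_mod_cast hn)
    linarith
  have hln : 0 ≤ Real.log n := Real.log_natCast_nonneg n
  have h2 := natCast_mul_devScale_sq (n := n) (by omega)
  have hr0 := devScale_nonneg n
  have hr1 := devScale_le_one n
  rw [div_le_iff₀ hσ] at hg
  have hsr : σ * devScale n ≤ 1 := mul_le_one₀ hσ1 hr0 hr1
  have hsr0 : 0 ≤ σ * devScale n := by positivity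
  rw [one_div, ← Real.exp_log (inv_pos.2 hn0), Real.log_inv, h2]
  refine Real.exp_le_exp.2 ?_
  calc _ ≤ σ * devScale n * (2 * Real.log n - g * (n * devScale n)) + Real.log n := by
        gcongr; linarith
    _ = (σ * devScale n) * (2 * Real.log n) - g * σ * (n * devScale n ^ 2) + Real.log n := by ring
    -- The allowance log(2n) costs 2 log n, the margin `g` gains 5 log n and the second-order term
    -- costs log n.
    _ ≤ 1 * (2 * Real.log n) - 5 * (n * devScale n ^ 2) + Real.log n := by
        gcongr
    _ ≤ - Real.log n := by rw [h2]; linarith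

lemma ratioTail_le_one {p : W → ℝ} (hp : p ∈ stdSimplex ℝ W) {K : W → Z → ℝ}
    (hK : ∀ w, K w ∈ stdSimplex ℝ Z) (θ : ℝ) : ratioTail p K θ ≤ 1 := by
  calc ratioTail p K θ ≤ ∑ w, ∑ z, p w * K w z := by
        refine Finset.sum_le_sum fun w _ => Finset.sum_le_sum fun z _ => ?_
        split_ifs
        exacts [le_rfl, mul_nonneg (hp.1 w) ((hK w).1 z)]
    _ = 1 := by simp only [← Finset.mul_sum, (hK _).2, mul_one, hp.2]

/-- Chernoff's bound with exponent `σ * devScale n`, for which the linear gain and the quadratic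
cost are both multiples of log n. The allowance log(2n) absorbs a factor n in the threshold and a
factor 2 from integer rounding. -/
lemma exists_ratioTail_pow_le {p : W → ℝ} (hp : p ∈ stdSimplex ℝ W) {K : W → Z → ℝ}
    (hK : ∀ w, K w ∈ stdSimplex ℝ Z) :
    ∃ g₀ : ℝ, ∀ n : ℕ, 1 ≤ n → ∀ g ≥ g₀, ∀ θ > 0,
      n * natInfo p K + g * (n * devScale n) ≤ Real.log θ + Real.log (2 * n) →
      ratioTail (powLaw n p) (powKernel n K) θ ≤ 1 / n := by
  obtain ⟨σ, hσ, hσ1, h⟩ := exists_tilted_sum_le hp hK 1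
  refine ⟨5 / σ, fun n hn1 g hg θ hθ hle => ?_⟩
  -- For n = 1 the bound is 1; the exponent estimate needs log 2 ≤ log n.
  obtain rfl | hn : n = 1 ∨ 2 ≤ n := by omega
  · simpa using ratioTail_le_one (powLaw_mem hp) (powKernel_mem hK) θ
  refine (ratioTail_pow_le hp hK (s := σ * devScale n) hθ
    (mul_nonneg hσ.le (devScale_nonneg n))).trans ?_
  have h1 := h (devScale n) (devScale_nonneg n) (devScale_le_one n)
  simp only [one_mul] at h1
  refine (mul_le_mul_of_nonneg_left (pow_le_pow_left₀ (Finset.sum_nonneg fun w _ =>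
    Finset.sum_nonneg fun z _ => mul_nonneg (mul_nonneg (hp.1 w) ((hK w).1 z))
      (Real.exp_nonneg _)) h1 n) (Real.exp_nonneg _)).trans ?_
  rw [← Real.exp_nat_mul, ← Real.exp_add]
  refine le_trans (le_of_eq ?_) (exp_deviation_le hn hσ hσ1 hg
    (d := n * natInfo p K - Real.log θ) (by linarith))
  congr 1; ring

lemma ratioHead_le_one {p : W → ℝ} (hp : p ∈ stdSimplex ℝ W) {K : W → Z → ℝ}
    (hK : ∀ w, K w ∈ stdSimplex ℝ Z) (θ : ℝ) : ratioHead p K θ ≤ 1 := by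
  calc ratioHead p K θ ≤ ∑ w, ∑ z, p w * K w z := by
        refine Finset.sum_le_sum fun w _ => Finset.sum_le_sum fun z _ => ?_
        split_ifs
        exacts [mul_nonneg (hp.1 w) ((hK w).1 z), le_rfl]
    _ = 1 := by simp only [← Finset.mul_sum, (hK _).2, mul_one, hp.2]

lemma exists_ratioHead_pow_le {p : W → ℝ} (hp : p ∈ stdSimplex ℝ W) {K : W → Z → ℝ}
    (hK : ∀ w, K w ∈ stdSimplex ℝ Z) :
    ∃ g₀ : ℝ, ∀ n : ℕ, 1 ≤ n → ∀ g ≥ g₀, ∀ θ > 0,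
      Real.log θ ≤ n * natInfo p K - g * (n * devScale n) + Real.log (2 * n) →
      ratioHead (powLaw n p) (powKernel n K) θ ≤ 1 / n := by
  obtain ⟨σ, hσ, hσ1, h⟩ := exists_tilted_sum_le hp hK (-1)
  refine ⟨5 / σ, fun n hn1 g hg θ hθ hle => ?_⟩
  obtain rfl | hn : n = 1 ∨ 2 ≤ n := by omega
  · simpa using ratioHead_le_one (powLaw_mem hp) (powKernel_mem hK) θ
  refine (ratioHead_pow_le hp hK (s := σ * devScale n) hθ
    (mul_nonneg hσ.le (devScale_nonneg n))).trans ?_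
  have h1 := h (devScale n) (devScale_nonneg n) (devScale_le_one n)
  refine (mul_le_mul_of_nonneg_left (pow_le_pow_left₀ (Finset.sum_nonneg fun w _ =>
    Finset.sum_nonneg fun z _ => mul_nonneg (mul_nonneg (hp.1 w) ((hK w).1 z))
      (Real.exp_nonneg _)) h1 n) (Real.exp_nonneg _)).trans ?_
  rw [← Real.exp_nat_mul, ← Real.exp_add]
  refine le_trans (le_of_eq ?_) (exp_deviation_le hn hσ hσ1 hg
    (d := Real.log θ - n * natInfo p K) (by linarith))
  congr 1; ring

end Chernoff

/-! ### Codes for i.i.d. targets -/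

section CodeExistence

variable {U W X Y V : Type*} [Fintype U] [Fintype W] [Fintype X] [Fintype Y] [Fintype V]

/-- The coordination code of a codebook over the `n`-fold product alphabets. -/
def codeOfCodebook {n M L : ℕ} {K : W → U → ℝ} {PX : U → W → X → ℝ} {PYX : X → Y → ℝ}
    {PV : W → Y → V → ℝ} (hK : ∀ w, K w ∈ stdSimplex ℝ U)
    (hPX : ∀ u w, PX u w ∈ stdSimplex ℝ X) (hPYX : ∀ x, PYX x ∈ stdSimplex ℝ Y)
    (hPV : ∀ w y, PV w y ∈ stdSimplex ℝ V) (m₀ : Fin L) (c : Fin M × Fin L → Fin n → W) :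
    Code U X Y V n M where
  enc u k := posteriorMap m₀ (powKernel n K) (powCond n PX) (fun m => c (k, m)) u
  enc_mem u _ := posteriorMap_mem m₀ (fun w => (powKernel_mem hK w).1) (powCond_mem hPX) _ u
  dec y k := posteriorMap m₀ (relayKernel (powKernel n K) (powCond n PX) (powKernel n PYX))
    (fun y w => powCond n PV w y) (fun m => c (k, m)) y
  dec_mem y _ := posteriorMap_mem m₀
    (fun w => (relayKernel_mem (powKernel_mem hK) (powCond_mem hPX) (powKernel_mem hPYX) w).1)
    (fun y w => powCond_mem hPV w y) _ y

lemma exists_code_l1Dist_le {p : W → ℝ} (hp : p ∈ stdSimplex ℝ W) {K : W → U → ℝ}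
    {PX : U → W → X → ℝ} {PYX : X → Y → ℝ} {PV : W → Y → V → ℝ}
    (hK : ∀ w, K w ∈ stdSimplex ℝ U) (hPX : ∀ u w, PX u w ∈ stdSimplex ℝ X)
    (hPYX : ∀ x, PYX x ∈ stdSimplex ℝ Y) (hPV : ∀ w y, PV w y ∈ stdSimplex ℝ V) :
    ∃ g > 0, ∀ n : ℕ, 1 ≤ n → ∀ M : ℕ, 1 ≤ M →
      0 ≤ natInfo p (relayKernel K PX PYX) - g * devScale n →
      natInfo p K + 2 * (g * devScale n) ≤ natInfo p (relayKernel K PX PYX) →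
      n * (natInfo p (jointKernel K PX PYX PV) - natInfo p (relayKernel K PX PYX) +
        2 * (g * devScale n)) ≤ Real.log M + Real.log 2 →
      ∃ c : Code U X Y V n M,
        c.l1Dist (outputLaw K p) PYX (outputLaw (jointKernel K PX PYX PV) p) ≤
          10 / Real.sqrt n := by
  have hR := relayKernel_mem hK hPX hPYX
  have hJ := jointKernel_mem hK hPX hPYX hPV
  obtain ⟨g₁, h₁⟩ := exists_ratioTail_pow_le hp hK
  obtain ⟨g₂, h₂⟩ := exists_ratioHead_pow_le hp hR
  obtain ⟨g₃, h₃⟩ := exists_ratioTail_pow_le hp hJ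
  refine ⟨max 1 (max g₁ (max g₂ g₃)), lt_max_of_lt_left one_pos, ?_⟩
  set g := max 1 (max g₁ (max g₂ g₃)) with hg
  intro n hn M hM hx hU hJM
  have hn0 : (0 : ℝ) < n := by exact_mod_cast hn
  have hM0 : (0 : ℝ) < M := by exact_mod_cast hM
  set r := devScale n
  -- `log L` is to lie just below the decoding limit; since 0 ≤ x, rounding exp x up costs at most a
  -- factor 2.
  set x := n * (natInfo p (relayKernel K PX PYX) - g * r) with hxdef
  have hx0 : 0 ≤ x := mul_nonneg hn0.le hx
  set L := ⌈Real.exp x⌉₊ with hL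
  have hL0 : 0 < L := Nat.ceil_pos.2 (Real.exp_pos x)
  have hL0' : (0 : ℝ) < L := by exact_mod_cast hL0
  have hLlow : x ≤ Real.log L := by
    rw [Real.le_log_iff_exp_le hL0']
    exact Nat.le_ceil _
  have hLup : Real.log L ≤ Real.log 2 + x := by
    have h2x : Real.log 2 + x = Real.log (2 * Real.exp x) := by
      rw [Real.log_mul two_ne_zero (Real.exp_pos x).ne', Real.log_exp]
    rw [h2x]
    refine Real.log_le_log hL0' ?_
    have := (Nat.ceil_lt_add_one (Real.exp_pos x).le).le
    have := Real.one_le_exp hx0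
    linarith
  have hlog2n : Real.log (2 * n) = Real.log 2 + Real.log n :=
    Real.log_mul two_ne_zero hn0.ne'
  have hlog2 : 0 < Real.log 2 := Real.log_pos one_lt_two
  have hsq : Real.sqrt (1 / n) = 1 / Real.sqrt n := by rw [Real.sqrt_div zero_le_one, Real.sqrt_one]
  -- Thresholds a factor n away from the codebook sizes make both square roots 1/√n and the
  -- collision term 1/n. With three tails of 1/n the total is 2/√n + 8/n ≤ 10/√n.
  obtain ⟨c, hc⟩ := exists_codebook_l1_le (p := powLaw n p) (K := powKernel n K)
    (PX := powCond n PX) (PYX := powKernel n PYX) (PV := powCond n PV)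
    hM ⟨0, hL0⟩ (powLaw_mem hp) (powKernel_mem hK) (powCond_mem hPX) (powKernel_mem hPYX)
    (powCond_mem hPV) (θ₁ := L / n) (θ₂ := L * n) (θ₃ := M * L / n) (by positivity)
    (by positivity) (by positivity)
  have e₁ : ratioTail (powLaw n p) (powKernel n K) (L / n) ≤ 1 / n := by
    refine h₁ n hn g (le_max_of_le_right (le_max_left _ _)) _ (by positivity) ?_
    rw [Real.log_div hL0'.ne' hn0.ne', hlog2n]
    have := mul_le_mul_of_nonneg_left hU hn0.le
    linarith
  have e₂ : ratioHead (powLaw n p) (powKernel n (relayKernel K PX PYX)) (L * n) ≤ 1 / n := by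
    refine h₂ n hn g (le_max_of_le_right (le_max_of_le_right (le_max_left _ _))) _
      (by positivity) ?_
    rw [Real.log_mul hL0'.ne' hn0.ne', hlog2n]
    linarith
  have e₃ : ratioTail (powLaw n p) (powKernel n (jointKernel K PX PYX PV)) (M * L / n) ≤
      1 / n := by
    refine h₃ n hn g (le_max_of_le_right (le_max_of_le_right (le_max_right _ _))) _
      (by positivity) ?_
    rw [Real.log_div (by positivity) hn0.ne', Real.log_mul hM0.ne' hL0'.ne', hlog2n]
    linarith
  refine ⟨codeOfCodebook hK hPX hPYX hPV ⟨0, hL0⟩ c, ?_⟩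
  simp only [outputLaw_pow, outputLaw_jointKernel_pow] at hc
  refine le_trans hc ?_
  rw [ratioTail_jointKernel_pow, relayKernel_pow]
  have s₁ : (L : ℝ) / n / L = 1 / n := by field_simp
  have s₂ : (L : ℝ) / (L * n) = 1 / n := by field_simp
  have s₃ : (M : ℝ) * L / n / (M * L) = 1 / n := by field_simp
  rw [s₁, s₂, s₃, hsq]
  have hle : 1 / (n : ℝ) ≤ 1 / Real.sqrt n := by
    refine one_div_le_one_div_of_le (Real.sqrt_pos.2 hn0) ?_
    rw [Real.sqrt_le_left hn0.le]
    have : (1 : ℝ) ≤ n := by exact_mod_cast hn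
    nlinarith
  have : 10 / Real.sqrt n = 10 * (1 / Real.sqrt n) := by ring
  rw [this]
  linarith

end CodeExistence

/-! ### Entropies and informations in nats -/

section Entropy

variable {Ω α β γ : Type*} [Fintype Ω] [Fintype α] [Fintype β] [Fintype γ]

omit [Fintype α] in
lemma law_nonneg {p : Ω → ℝ} (hp : ∀ ω, 0 ≤ p ω) (A : Ω → α) (a : α) : 0 ≤ law p A a :=
  Finset.sum_nonneg fun ω _ => by split_ifs; exacts [hp ω, le_rfl]

lemma sum_law_mul (p : Ω → ℝ) (A : Ω → α) (f : α → ℝ) :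
    ∑ a, law p A a * f a = ∑ ω, p ω * f (A ω) := by
  classical
  simp only [law, Finset.sum_mul, ite_mul, zero_mul]
  rw [Finset.sum_comm]
  simp

lemma law_mem {p : Ω → ℝ} (hp : p ∈ stdSimplex ℝ Ω) (A : Ω → α) : law p A ∈ stdSimplex ℝ α :=
  ⟨law_nonneg hp.1 A, by simpa [hp.2] using sum_law_mul p A fun _ => 1⟩

omit [Fintype α] in
lemma law_le_one {p : Ω → ℝ} (hp : p ∈ stdSimplex ℝ Ω) (A : Ω → α) (a : α) : law p A a ≤ 1 := by
  rw [← hp.2]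
  exact Finset.sum_le_sum fun ω _ => by split_ifs; exacts [le_rfl, hp.1 ω]

omit [Fintype β] in
lemma sum_law_prodMk_left (p : Ω → ℝ) (A : Ω → α) (B : Ω → β) (b : β) :
    ∑ a, law p (fun ω => (A ω, B ω)) (a, b) = law p B b := by
  classical
  simp only [law]
  rw [Finset.sum_comm]
  refine Finset.sum_congr rfl fun ω _ => ?_
  by_cases h : B ω = b <;> simp [h]

omit [Fintype α] in
lemma sum_law_prodMk_right (p : Ω → ℝ) (A : Ω → α) (B : Ω → β) (a : α) :
    ∑ b, law p (fun ω => (A ω, B ω)) (a, b) = law p A a := by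
  classical
  simp only [law]
  rw [Finset.sum_comm]
  refine Finset.sum_congr rfl fun ω _ => ?_
  by_cases h : A ω = a <;> simp [h]

lemma entropy_nonneg {p : Ω → ℝ} (hp : p ∈ stdSimplex ℝ Ω) (A : Ω → α) : 0 ≤ entropy p A :=
  Finset.sum_nonneg fun a _ => div_nonneg
    (Real.negMulLog_nonneg (law_nonneg hp.1 A a) (law_le_one hp A a)) (Real.log_pos one_lt_two).le

lemma entropy_mul_log_two (p : Ω → ℝ) (A : Ω → α) :
    entropy p A * Real.log 2 = -∑ a, law p A a * Real.log (law p A a) := by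
  rw [entropy, ← Finset.sum_div, div_mul_cancel₀ _ (Real.log_pos one_lt_two).ne',
    ← Finset.sum_neg_distrib]
  exact Finset.sum_congr rfl fun a _ => by simp [Real.negMulLog]

/-- Conditional entropy is nonnegative. -/
lemma entropy_le_entropy_prodMk {p : Ω → ℝ} (hp : p ∈ stdSimplex ℝ Ω) (A : Ω → α) (B : Ω → β) :
    entropy p B ≤ entropy p (fun ω => (A ω, B ω)) := by
  refine le_of_mul_le_mul_right ?_ (Real.log_pos one_lt_two)
  rw [entropy_mul_log_two, entropy_mul_log_two, neg_le_neg_iff, Fintype.sum_prod_type,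
    Finset.sum_comm]
  refine Finset.sum_le_sum fun b _ => ?_
  conv_rhs => rw [← sum_law_prodMk_left p A B b, Finset.sum_mul]
  rw [sum_law_prodMk_left]
  refine Finset.sum_le_sum fun a _ => ?_
  have h0 := law_nonneg hp.1 (fun ω => (A ω, B ω)) (a, b)
  rcases h0.eq_or_lt with h | h
  · simp [← h]
  · refine mul_le_mul_of_nonneg_left (Real.log_le_log h ?_) h0
    rw [← sum_law_prodMk_left p A B b]
    exact Finset.single_le_sum (f := fun a => law p (fun ω => (A ω, B ω)) (a, b))
      (fun a _ => law_nonneg hp.1 _ _) (Finset.mem_univ a)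

/-- Mutual information is the mean of the information density. -/
lemma mutualInfo_mul_log_two {p : Ω → ℝ} (hp : p ∈ stdSimplex ℝ Ω) (A : Ω → α) (B : Ω → β)
    {K : α → β → ℝ}
    (hK : ∀ a b, law p (fun ω => (A ω, B ω)) (a, b) = law p A a * K a b) :
    mutualInfo p A B * Real.log 2 = natInfo (law p A) K := by
  have hq : ∀ b, outputLaw K (law p A) b = law p B b := fun b => by
    rw [← sum_law_prodMk_left p A B b]
    exact Finset.sum_congr rfl fun a _ => (hK a b).symm
  have e1 : mutualInfo p A B * Real.log 2 = entropy p A * Real.log 2 + entropy p B * Real.log 2 -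
      entropy p (fun ω => (A ω, B ω)) * Real.log 2 := by
    rw [mutualInfo, condEntropy]; ring
  have eA : ∑ a, law p A a * Real.log (law p A a) =
      ∑ a, ∑ b, law p (fun ω => (A ω, B ω)) (a, b) * Real.log (law p A a) := by
    simp only [← Finset.sum_mul, sum_law_prodMk_right]
  have eB : ∑ b, law p B b * Real.log (law p B b) =
      ∑ a, ∑ b, law p (fun ω => (A ω, B ω)) (a, b) * Real.log (law p B b) := by
    rw [Finset.sum_comm]
    simp only [← Finset.sum_mul, sum_law_prodMk_left]
  rw [e1, entropy_mul_log_two, entropy_mul_log_two, entropy_mul_log_two, eA, eB,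
    Fintype.sum_prod_type, natInfo, ← sub_eq_zero]
  simp only [← Finset.sum_neg_distrib, ← Finset.sum_add_distrib, ← Finset.sum_sub_distrib]
  refine Finset.sum_eq_zero fun a _ => Finset.sum_eq_zero fun b _ => ?_
  rw [hq, ← hK]
  have h0 := law_nonneg hp.1 (fun ω => (A ω, B ω)) (a, b)
  rcases h0.eq_or_lt with h | h
  · simp [← h]
  · have hab := hK a b
    have hA : law p A a ≠ 0 := fun h' => by rw [h', zero_mul] at hab; exact h.ne' hab
    have hk : K a b ≠ 0 := fun h' => by rw [h', mul_zero] at hab; exact h.ne' hab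
    have hB : law p B b ≠ 0 := by
      refine (h.trans_le ?_).ne'
      rw [← sum_law_prodMk_left p A B b]
      exact Finset.single_le_sum (f := fun a => law p (fun ω => (A ω, B ω)) (a, b))
        (fun a _ => law_nonneg hp.1 _ _) (Finset.mem_univ a)
    rw [Real.log_div hk hB, hab, Real.log_mul hA hk]
    ring

lemma mutualInfo_le_entropy {p : Ω → ℝ} (hp : p ∈ stdSimplex ℝ Ω) (A : Ω → α) (B : Ω → β) :
    mutualInfo p A B ≤ entropy p A := by
  have := entropy_le_entropy_prodMk hp A B
  rw [mutualInfo, condEntropy]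
  linarith

/-- Chain rule. -/
lemma condMutualInfo_add_mutualInfo (p : Ω → ℝ) (A : Ω → α) (B : Ω → β) (C : Ω → γ) :
    condMutualInfo p A B C + mutualInfo p A C = mutualInfo p A (fun ω => (B ω, C ω)) := by
  rw [condMutualInfo, mutualInfo, mutualInfo]
  ring

/-- Data processing. -/
lemma natInfo_law_le {p : α → ℝ} (hp : p ∈ stdSimplex ℝ α) {K : α → β → ℝ}
    (hK : ∀ a, K a ∈ stdSimplex ℝ β) (f : β → γ) :
    natInfo p (fun a => law (K a) f) ≤ natInfo p K := by
  set R : α → γ → ℝ := fun a => law (K a) f with hRdef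
  have hR : ∀ a, R a ∈ stdSimplex ℝ γ := fun a => law_mem (hK a) f
  set q := outputLaw K p with hq
  set t := outputLaw R p with ht
  have hq0 : ∀ b, 0 ≤ q b := fun b =>
    Finset.sum_nonneg fun a _ => mul_nonneg (hp.1 a) ((hK a).1 b)
  have ht0 : ∀ c, 0 ≤ t c := fun c =>
    Finset.sum_nonneg fun a _ => mul_nonneg (hp.1 a) ((hR a).1 c)
  have hq1 : ∑ b, q b = 1 := by
    simp only [hq, outputLaw]
    rw [Finset.sum_comm]
    simp [← Finset.mul_sum, (hK _).2, hp.2]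
  have e1 : natInfo p R = ∑ a, ∑ b, p a * K a b * Real.log (R a (f b) / t (f b)) := by
    simp only [natInfo, mul_assoc, ← Finset.mul_sum]
    refine Finset.sum_congr rfl fun a _ => ?_
    congr 1
    exact sum_law_mul (K a) f fun c => Real.log (R a c / t c)
  -- The inequality log x ≤ x − 1 at x = Rq/(tK). Summed, the left side is 1 minus a quantity at
  -- most 1, hence nonnegative.
  have hpt : ∀ a b, p a * K a b - p a * (R a (f b) / t (f b) * q b) ≤
      p a * K a b * Real.log (K a b / q b) -
        p a * K a b * Real.log (R a (f b) / t (f b)) := by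
    intro a b
    rcases (mul_nonneg (hp.1 a) ((hK a).1 b)).eq_or_lt with h | h
    · rw [← h]
      have := mul_nonneg (hp.1 a) (mul_nonneg (div_nonneg ((hR a).1 (f b)) (ht0 (f b))) (hq0 b))
      linarith
    · have hpa : 0 < p a := lt_of_le_of_ne (hp.1 a) fun h' => by rw [← h', zero_mul] at h; simp at h
      have hKb : 0 < K a b :=
        lt_of_le_of_ne ((hK a).1 b) fun h' => by rw [← h', mul_zero] at h; simp at h
      have hqb : 0 < q b := h.trans_le (Finset.single_le_sum (f := fun a => p a * K a b)
        (fun a _ => mul_nonneg (hp.1 a) ((hK a).1 b)) (Finset.mem_univ a))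
      have hRb : 0 < R a (f b) := by
        classical
        refine hKb.trans_le ?_
        refine le_trans (le_of_eq ?_) (Finset.single_le_sum
          (f := fun b' => if f b' = f b then K a b' else 0)
          (fun b' _ => by split_ifs; exacts [(hK a).1 b', le_rfl])
          (Finset.mem_univ b) |>.trans (le_of_eq ?_))
        · simp
        · simp [hRdef, law]
      have htb : 0 < t (f b) := (mul_pos hpa hRb).trans_le
        (Finset.single_le_sum (f := fun a => p a * R a (f b))
          (fun a _ => mul_nonneg (hp.1 a) ((hR a).1 (f b))) (Finset.mem_univ a))
      have hlog := Real.log_le_sub_one_of_pos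
        (div_pos (mul_pos (div_pos hRb htb) hqb) hKb)
      rw [Real.log_div (mul_pos (div_pos hRb htb) hqb).ne' hKb.ne',
        Real.log_mul (div_pos hRb htb).ne' hqb.ne'] at hlog
      rw [Real.log_div hKb.ne' hqb.ne']
      have h2 := mul_le_mul_of_nonneg_left hlog h.le
      have h3 : p a * K a b * (R a (f b) / t (f b) * q b / K a b - 1) =
          p a * (R a (f b) / t (f b) * q b) - p a * K a b := by
        field_simp
      rw [h3] at h2
      linarith
  have hsum := Finset.sum_le_sum fun a (_ : a ∈ Finset.univ) =>
    Finset.sum_le_sum fun b (_ : b ∈ Finset.univ) => hpt a b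
  simp only [Finset.sum_sub_distrib] at hsum
  rw [← e1] at hsum
  have s1 : ∑ a, ∑ b, p a * K a b = 1 := by simp only [← Finset.mul_sum, (hK _).2, mul_one, hp.2]
  have s2 : ∑ a, ∑ b, p a * (R a (f b) / t (f b) * q b) ≤ 1 := by
    rw [Finset.sum_comm, ← hq1]
    refine Finset.sum_le_sum fun b _ => ?_
    have : ∑ a, p a * (R a (f b) / t (f b) * q b) = t (f b) / t (f b) * q b := by
      conv_rhs => rw [show t (f b) / t (f b) = (∑ a, p a * R a (f b)) / t (f b) from rfl]
      rw [Finset.sum_div, Finset.sum_mul]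
      exact Finset.sum_congr rfl fun a _ => by ring
    rw [this]
    exact mul_le_of_le_one_left (hq0 b) (div_self_le_one _)
  have : natInfo p K = ∑ a, ∑ b, p a * K a b * Real.log (K a b / q b) := rfl
  linarith

/-- Data processing to a one-point alphabet, where the information vanishes. -/
lemma natInfo_nonneg {p : α → ℝ} (hp : p ∈ stdSimplex ℝ α) {K : α → β → ℝ}
    (hK : ∀ a, K a ∈ stdSimplex ℝ β) : 0 ≤ natInfo p K := by
  have h := natInfo_law_le hp hK (fun _ => ())
  have h1 : ∀ a, law (K a) (fun _ => ()) () = 1 := fun a => by simp [law, (hK a).2]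
  simpa [natInfo, outputLaw, h1, hp.2] using h

lemma natInfo_comp_equiv (e : γ ≃ β) (p : α → ℝ) (K : α → β → ℝ) :
    natInfo p (fun a c => K a (e c)) = natInfo p K := by
  simp only [natInfo]
  refine Finset.sum_congr rfl fun a _ => ?_
  exact e.sum_comp (fun b => p a * K a b * Real.log (K a b / outputLaw K p b))

end Entropy

/-! ### The Gaussian tail -/

lemma integrable_gaussianDensity :
    MeasureTheory.Integrable fun x : ℝ => (1 / Real.sqrt (2 * Real.pi)) * Real.exp (-x ^ 2 / 2) := by
  have := (integrable_exp_neg_mul_sq (b := 1 / 2) (by norm_num)).const_mul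
    (1 / Real.sqrt (2 * Real.pi))
  refine this.congr (Filter.Eventually.of_forall fun x => ?_)
  dsimp only
  congr 2
  ring

lemma gaussianQ_zero : gaussianQ 0 = 1 / 2 := by
  have h := integral_gaussian_Ioi (1 / 2)
  have h1 : ∀ x : ℝ, Real.exp (-x ^ 2 / 2) = Real.exp (-(1 / 2) * x ^ 2) := fun x => by
    congr 1; ring
  rw [gaussianQ, MeasureTheory.integral_const_mul]
  simp only [h1]
  rw [h, show Real.pi / (1 / 2) = 2 * Real.pi by ring]
  have : 0 < Real.sqrt (2 * Real.pi) := Real.sqrt_pos.2 (by positivity)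
  field_simp

lemma half_lt_gaussianQ {t : ℝ} (ht : t < 0) : 1 / 2 < gaussianQ t := by
  have hint := integrable_gaussianDensity
  have hsplit : gaussianQ t = (∫ x in Set.Ioc t 0,
      (1 / Real.sqrt (2 * Real.pi)) * Real.exp (-x ^ 2 / 2)) + gaussianQ 0 := by
    rw [gaussianQ, gaussianQ, ← MeasureTheory.setIntegral_union
      (Set.Ioc_disjoint_Ioi le_rfl) measurableSet_Ioi hint.integrableOn hint.integrableOn,
      Set.Ioc_union_Ioi_eq_Ioi ht.le]
  have hpos : 0 < ∫ x in Set.Ioc t 0,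
      (1 / Real.sqrt (2 * Real.pi)) * Real.exp (-x ^ 2 / 2) := by
    rw [← intervalIntegral.integral_of_le ht.le]
    refine intervalIntegral.intervalIntegral_pos_of_pos hint.intervalIntegrable (fun x => ?_) ht
    have : 0 < Real.sqrt (2 * Real.pi) := Real.sqrt_pos.2 (by positivity)
    positivity
  rw [hsplit, gaussianQ_zero]
  linarith

/-- No negative t satisfies Q(t) ≤ 1/2; an empty set has infimum 0 by convention. -/
lemma gaussianQInv_nonneg {p : ℝ} (hp : p ≤ 1 / 2) : 0 ≤ gaussianQInv p := by
  refine Real.sInf_nonneg fun t ht => ?_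
  by_contra h
  exact absurd ((half_lt_gaussianQ (not_le.1 h)).trans_le (le_trans ht hp)) (lt_irrefl _)

/-! ### The inner bound -/

section InnerBound

variable {U W X Y V : Type*} [Fintype U] [Fintype W] [Fintype X] [Fintype Y] [Fintype V]

/-- An outcome without its auxiliary coordinate. -/
def forgetW (ω : Outcome U W X Y V) : U × X × Y × V := (ω.1, ω.2.2)

omit [Fintype Y] in
lemma Factorizes.exists_backwardKernel {PU : U → ℝ} (hPU : PU ∈ stdSimplex ℝ U)
    {PYX : X → Y → ℝ} {J : Outcome U W X Y V → ℝ} (h : Factorizes PU PYX J) :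
    ∃ (p : W → ℝ) (K : W → U → ℝ) (PX : U → W → X → ℝ) (PV : W → Y → V → ℝ),
      p ∈ stdSimplex ℝ W ∧ (∀ w, K w ∈ stdSimplex ℝ U) ∧ (∀ u w, PX u w ∈ stdSimplex ℝ X) ∧
      (∀ w y, PV w y ∈ stdSimplex ℝ V) ∧ outputLaw K p = PU ∧
      ∀ u w r, J (u, w, r) = p w * jointKernel K PX PYX PV w (u, r) := by
  obtain ⟨PW, PX, PV, hPW, hPX, hPV, hJ⟩ := h
  set p : W → ℝ := fun w => ∑ u, PU u * PW u w with hp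
  -- Bayes' rule; at letters of probability zero the value `PU` only serves to make `K w` a
  -- distribution.
  set K : W → U → ℝ := fun w u => if p w = 0 then PU u else PU u * PW u w / p w with hK
  have h0 : ∀ u w, 0 ≤ PU u * PW u w := fun u w => mul_nonneg (hPU.1 u) ((hPW u).1 w)
  have hpK : ∀ w u, p w * K w u = PU u * PW u w := by
    intro w u
    by_cases hw : p w = 0
    · rw [hw, zero_mul]
      exact ((Finset.sum_eq_zero_iff_of_nonneg fun u _ => h0 u w).1 hw u (Finset.mem_univ u)).symm
    · simp only [hK, hw, if_false]
      field_simp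
  have hp0 : ∀ w, 0 ≤ p w := fun w => Finset.sum_nonneg fun u _ => h0 u w
  refine ⟨p, K, PX, PV, ⟨hp0, ?_⟩, fun w => ?_, hPX, hPV, ?_, ?_⟩
  · simp only [hp]
    rw [Finset.sum_comm]
    simp only [← Finset.mul_sum, (hPW _).2, mul_one, hPU.2]
  · by_cases hw : p w = 0
    · simpa only [hK, hw, if_true] using hPU
    · refine ⟨fun u => ?_, ?_⟩
      · simp only [hK, hw, if_false]
        exact div_nonneg (h0 u w) (hp0 w)
      · simp only [hK, hw, if_false]
        rw [← Finset.sum_div]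
        exact div_self hw
  · funext u
    simp only [outputLaw, hpK, ← Finset.mul_sum, (hPW u).2, mul_one]
  · rintro u w ⟨x, y, v⟩
    rw [hJ, jointKernel, ← hpK w u]
    ring

lemma law_equiv {α β : Type*} [Fintype α] (q : α → ℝ) (e : α ≃ β) (b : β) :
    law q e b = q (e.symm b) := by
  classical
  simp [law, ← Equiv.eq_symm_apply]

variable {p : W → ℝ} {Q : W → U × X × Y × V → ℝ} {J : Outcome U W X Y V → ℝ}

lemma law_rvW_forgetW {γ : Type*} (hJ : ∀ u w r, J (u, w, r) = p w * Q w (u, r))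
    (f : U × X × Y × V → γ) (w : W) (c : γ) :
    law J (fun ω => (rvW ω, f (forgetW ω))) (w, c) = p w * law (Q w) f c := by
  classical
  simp only [law, rvW, forgetW, Fintype.sum_prod_type (α₁ := U), Prod.mk.injEq, Finset.mul_sum]
  refine Finset.sum_congr rfl fun u _ => ?_
  rw [Fintype.sum_prod_type, Finset.sum_eq_single w]
  · refine Finset.sum_congr rfl fun r _ => ?_
    by_cases h : f (u, r) = c <;> simp [h, hJ]
  · intro w' _ hw'
    simp [hw']
  · simp

lemma law_rvW (hQ : ∀ w, Q w ∈ stdSimplex ℝ (U × X × Y × V))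
    (hJ : ∀ u w r, J (u, w, r) = p w * Q w (u, r)) : law J rvW = p := by
  funext w
  rw [← sum_law_prodMk_right J rvW (fun ω => ()) w]
  have := law_rvW_forgetW hJ (fun _ => ()) w ()
  simpa [law, (hQ w).2] using this

lemma law_forgetW (hJ : ∀ u w r, J (u, w, r) = p w * Q w (u, r)) :
    law J forgetW = outputLaw Q p := by
  funext z
  rw [← sum_law_prodMk_left J rvW forgetW z]
  refine Finset.sum_congr rfl fun w _ => ?_
  exact (law_rvW_forgetW hJ (fun z => z) w z).trans
    (congrArg (p w * ·) (law_equiv (Q w) (Equiv.refl _) z))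

lemma mem_stdSimplex_of_eq_mul (hp : p ∈ stdSimplex ℝ W)
    (hQ : ∀ w, Q w ∈ stdSimplex ℝ (U × X × Y × V))
    (hJ : ∀ u w r, J (u, w, r) = p w * Q w (u, r)) : J ∈ stdSimplex ℝ (Outcome U W X Y V) := by
  refine ⟨fun ω => ?_, ?_⟩
  · rw [show ω = (ω.1, ω.2.1, ω.2.2) from rfl, hJ]
    exact mul_nonneg (hp.1 _) ((hQ _).1 _)
  · have h := sum_law_mul J rvW fun _ => 1
    rw [law_rvW hQ hJ] at h
    simpa [hp.2] using h.symm

/-- Taking for `f` a projection or a reordering of (U, X, Y, V) covers I(W;U), I(W;Y) and I(W;UXVY)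
at once. -/
lemma mutualInfo_rvW_forgetW {γ : Type*} [Fintype γ] (hp : p ∈ stdSimplex ℝ W)
    (hQ : ∀ w, Q w ∈ stdSimplex ℝ (U × X × Y × V))
    (hJ : ∀ u w r, J (u, w, r) = p w * Q w (u, r)) (f : U × X × Y × V → γ) :
    mutualInfo J rvW (fun ω => f (forgetW ω)) * Real.log 2 =
      natInfo p (fun w => law (Q w) f) := by
  have hW := law_rvW hQ hJ
  rw [mutualInfo_mul_log_two (mem_stdSimplex_of_eq_mul hp hQ hJ) rvW (fun ω => f (forgetW ω))
    (K := fun w => law (Q w) f) fun w c => by rw [law_rvW_forgetW hJ, hW], hW]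

omit [Fintype W] in
lemma law_jointKernel_fst {K : W → U → ℝ} {PX : U → W → X → ℝ} {PYX : X → Y → ℝ}
    {PV : W → Y → V → ℝ} (hPX : ∀ u w, PX u w ∈ stdSimplex ℝ X)
    (hPYX : ∀ x, PYX x ∈ stdSimplex ℝ Y) (hPV : ∀ w y, PV w y ∈ stdSimplex ℝ V) (w : W) :
    law (jointKernel K PX PYX PV w) (fun z => z.1) = K w := by
  classical
  funext u
  simp only [law, Fintype.sum_prod_type, jointKernel]
  rw [Finset.sum_eq_single u (fun u' _ h => by simp [h]) (by simp)]
  simp [← Finset.mul_sum, (hPV _ _).2, (hPYX _).2, (hPX _ _).2]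

omit [Fintype W] in
lemma law_jointKernel_relay {K : W → U → ℝ} {PX : U → W → X → ℝ} {PYX : X → Y → ℝ}
    {PV : W → Y → V → ℝ} (hPV : ∀ w y, PV w y ∈ stdSimplex ℝ V) (w : W) :
    law (jointKernel K PX PYX PV w) (fun z => z.2.2.1) = relayKernel K PX PYX w := by
  classical
  funext y
  simp only [law, Fintype.sum_prod_type, jointKernel, relayKernel]
  refine Finset.sum_congr rfl fun u _ => Finset.sum_congr rfl fun x _ => ?_
  rw [Finset.sum_eq_single y (fun y' _ h => by simp [h]) (by simp)]
  simp [← Finset.mul_sum, (hPV _ _).2]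

/-- The reordering `(U, X, Y, V) ≃ ((U, X, V), Y)`. -/
def splitY (U X Y V : Type*) : (U × X × Y × V) ≃ (U × X × V) × Y where
  toFun z := ((z.1, z.2.1, z.2.2.2), z.2.2.1)
  invFun t := (t.1.1, t.1.2.1, t.2, t.1.2.2)
  left_inv _ := rfl
  right_inv _ := rfl

/-- Achievability at all block lengths, with a deviation term of order `√(log n / n)`. -/
lemma Factorizes.exists_achievable {PU : U → ℝ} (hPU : PU ∈ stdSimplex ℝ U)
    {PYX : X → Y → ℝ} (hPYX : ∀ x, PYX x ∈ stdSimplex ℝ Y) {J : Outcome U W X Y V → ℝ}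
    (h : Factorizes PU PYX J) :
    ∃ g > 0, ∀ n : ℕ, 1 ≤ n → ∀ R₀ : ℝ,
      mutualInfo J rvW rvU + g * devScale n ≤ mutualInfo J rvW rvY →
      condMutualInfo J rvW (fun ω => (rvU ω, rvX ω, rvV ω)) rvY + g * devScale n ≤ R₀ →
      Achievable PU PYX n (10 / Real.sqrt n)
        (law J (fun ω => (rvU ω, rvX ω, rvY ω, rvV ω))) R₀ := by
  obtain ⟨p, K, PX, PV, hp, hK, hPX, hPV, hPUK, hJ⟩ := h.exists_backwardKernel hPU
  have hQ := jointKernel_mem hK hPX hPYX hPV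
  have hJmem := mem_stdSimplex_of_eq_mul hp hQ hJ
  have hl2 : 0 < Real.log 2 := Real.log_pos one_lt_two
  obtain ⟨g, hg, hcode⟩ := exists_code_l1Dist_le hp hK hPX hPYX hPV
  have eU : mutualInfo J rvW rvU * Real.log 2 = natInfo p K := by
    have := mutualInfo_rvW_forgetW hp hQ hJ (fun z => z.1)
    simpa only [law_jointKernel_fst hPX hPYX hPV] using! this
  have eY : mutualInfo J rvW rvY * Real.log 2 = natInfo p (relayKernel K PX PYX) := by
    have := mutualInfo_rvW_forgetW hp hQ hJ (fun z => z.2.2.1)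
    simpa only [law_jointKernel_relay hPV] using! this
  have eJ : (condMutualInfo J rvW (fun ω => (rvU ω, rvX ω, rvV ω)) rvY + mutualInfo J rvW rvY) *
      Real.log 2 = natInfo p (jointKernel K PX PYX PV) := by
    rw [condMutualInfo_add_mutualInfo, ← natInfo_comp_equiv (splitY U X Y V).symm]
    refine (mutualInfo_rvW_forgetW hp hQ hJ (splitY U X Y V)).trans ?_
    congr 1
    funext w b
    exact law_equiv _ _ _
  have hRJ : natInfo p (relayKernel K PX PYX) ≤ natInfo p (jointKernel K PX PYX PV) := by
    have := natInfo_law_le hp hQ (fun z => z.2.2.1)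
    simpa only [law_jointKernel_relay hPV] using this
  -- The division by log 2 converts nats to bits. Of the margin 2g, one g separates log L from the
  -- decoding limit and one from the covering limit.
  refine ⟨2 * g / Real.log 2, by positivity, fun n hn R₀ h1 h2 => ?_⟩
  have hr := devScale_nonneg n
  have hgr : 0 ≤ g * devScale n := mul_nonneg hg.le hr
  have hscale : 2 * g / Real.log 2 * devScale n * Real.log 2 = 2 * (g * devScale n) := by
    field_simp
  have h1' := mul_le_mul_of_nonneg_right h1 hl2.le
  have h2' := mul_le_mul_of_nonneg_right h2 hl2.le
  rw [add_mul, hscale] at h1' h2'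
  rw [add_mul] at eJ
  rw [eU, eY] at h1'
  have hK0 := natInfo_nonneg hp hK
  have hR₀ : 0 ≤ R₀ := by
    by_contra hneg
    have := mul_neg_of_neg_of_pos (not_le.1 hneg) hl2
    linarith
  have hn0 : (0 : ℝ) < n := by exact_mod_cast hn
  have hpow : (1 : ℝ) ≤ 2 ^ ((n : ℝ) * R₀) :=
    Real.one_le_rpow one_le_two (mul_nonneg hn0.le hR₀)
  have hM : 1 ≤ ⌊(2 : ℝ) ^ ((n : ℝ) * R₀)⌋₊ := (Nat.one_le_floor_iff _).2 hpow
  -- The floor of a number at least 1 is at least half of it, whence the log 2.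
  have hlogM : n * R₀ * Real.log 2 ≤
      Real.log (⌊(2 : ℝ) ^ ((n : ℝ) * R₀)⌋₊ : ℝ) + Real.log 2 := by
    have hM0 : (1 : ℝ) ≤ (⌊(2 : ℝ) ^ ((n : ℝ) * R₀)⌋₊ : ℝ) := by exact_mod_cast hM
    rw [← Real.log_rpow two_pos, ← Real.log_mul (by positivity) two_ne_zero]
    refine Real.log_le_log (by positivity) ?_
    have := Nat.lt_floor_add_one ((2 : ℝ) ^ ((n : ℝ) * R₀))
    linarith
  obtain ⟨c, hc⟩ := hcode n hn _ hM (by linarith) (by linarith) (by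
    refine le_trans ?_ hlogM
    rw [mul_assoc]
    refine mul_le_mul_of_nonneg_left ?_ hn0.le
    linarith)
  refine ⟨law_mem hJmem _, hR₀, c, ?_⟩
  rw [hPUK, ← law_forgetW hJ] at hc
  exact hc

/-- If one of the two coefficients of the typicality parameter vanishes then so does the mutual
information between the auxiliary variable and the channel output. -/
lemma mutualInfo_nonpos_of_const_nonpos {J : Outcome U W X Y V → ℝ}
    (hJ : J ∈ stdSimplex ℝ (Outcome U W X Y V)) (h : min (const₁ J) (const₃ J) ≤ 0) :
    mutualInfo J rvW rvY ≤ 0 := by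
  refine (mutualInfo_le_entropy hJ rvW rvY).trans ?_
  rcases min_le_iff.1 h with h | h
  · have h1 := entropy_le_entropy_prodMk hJ rvU rvW
    have h2 := entropy_nonneg hJ rvU
    rw [const₁] at h
    linarith
  · have h1 := entropy_nonneg hJ (fun ω => ω)
    rw [const₃] at h
    linarith

lemma Factorizes.mem_stdSimplex {PU : U → ℝ} (hPU : PU ∈ stdSimplex ℝ U)
    {PYX : X → Y → ℝ} (hPYX : ∀ x, PYX x ∈ stdSimplex ℝ Y) {J : Outcome U W X Y V → ℝ}
    (h : Factorizes PU PYX J) : J ∈ stdSimplex ℝ (Outcome U W X Y V) := by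
  obtain ⟨p, K, PX, PV, hp, hK, hPX, hPV, -, hJ⟩ := h.exists_backwardKernel hPU
  exact mem_stdSimplex_of_eq_mul hp (jointKernel_mem hK hPX hPYX hPV) hJ

lemma Factorizes.mutualInfo_rvU_nonneg {PU : U → ℝ} (hPU : PU ∈ stdSimplex ℝ U)
    {PYX : X → Y → ℝ} (hPYX : ∀ x, PYX x ∈ stdSimplex ℝ Y) {J : Outcome U W X Y V → ℝ}
    (h : Factorizes PU PYX J) : 0 ≤ mutualInfo J rvW rvU := by
  obtain ⟨p, K, PX, PV, hp, hK, hPX, hPV, -, hJ⟩ := h.exists_backwardKernel hPU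
  have hQ := jointKernel_mem hK hPX hPYX hPV
  refine nonneg_of_mul_nonneg_left ?_ (Real.log_pos one_lt_two)
  exact (natInfo_nonneg hp fun w => law_mem (hQ w) _).trans_eq
    (mutualInfo_rvW_forgetW hp hQ hJ (fun z => z.1)).symm

/-- Achievability when the typicality parameter is at least of order `√(log n / n)`. -/
lemma Factorizes.exists_threshold {PU : U → ℝ} (hPU : PU ∈ stdSimplex ℝ U)
    {PYX : X → Y → ℝ} (hPYX : ∀ x, PYX x ∈ stdSimplex ℝ Y) {J : Outcome U W X Y V → ℝ}
    (h : Factorizes PU PYX J) :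
    ∃ A > 0, ∀ n : ℕ, 1 ≤ n → ∀ ε₁ > 0, A * Real.log n ≤ n * ε₁ ^ 2 → ∀ δ R₀ : ℝ, 0 ≤ δ →
      (2 ≤ n → 0 < δ) →
      mutualInfo J rvW rvU ≤ mutualInfo J rvW rvY - (const₁ J * ε₁ + δ) →
      condMutualInfo J rvW (fun ω => (rvU ω, rvX ω, rvV ω)) rvY + (const₃ J * ε₁ + δ) ≤ R₀ →
      Achievable PU PYX n (10 / Real.sqrt n)
        (law J (fun ω => (rvU ω, rvX ω, rvY ω, rvV ω))) R₀ := by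
  obtain ⟨g, hg, hach⟩ := h.exists_achievable hPU hPYX
  have hJ := h.mem_stdSimplex hPU hPYX
  have hc₁ : 0 ≤ const₁ J := add_nonneg (entropy_nonneg hJ _) (entropy_nonneg hJ _)
  have hc₃ : 0 ≤ const₃ J := add_nonneg (entropy_nonneg hJ _) (entropy_nonneg hJ _)
  set c := min (const₁ J) (const₃ J) with hc
  have hc0 : 0 ≤ c := le_min hc₁ hc₃
  -- With A = (g/c)² the threshold inequality becomes `g * devScale n ≤ c * ε₁`; for c = 0 any
  -- positive value will do.
  refine ⟨if c = 0 then 1 else (g / c) ^ 2, ?_, fun n hn ε₁ hε hA δ R₀ hδ hδ' h1 h2 => ?_⟩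
  · split_ifs
    · exact one_pos
    · positivity
  have hn0 : (0 : ℝ) < n := by exact_mod_cast hn
  have hdev : g * devScale n ≤ c * ε₁ := by
    obtain rfl | hn2 : n = 1 ∨ 2 ≤ n := by omega
    · simpa [devScale] using mul_nonneg hc0 hε.le
    · by_cases hcz : c = 0
      -- Here 0 ≤ I(W;U) ≤ I(W;Y) − δ < 0 is absurd. This is where strict positivity of δ is needed;
      -- for n = 1 the deviation is zero instead.
      · have := mutualInfo_nonpos_of_const_nonpos hJ hcz.le
        have := h.mutualInfo_rvU_nonneg hPU hPYX
        have := mul_nonneg hc₁ hε.le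
        have := hδ' hn2
        linarith
      · have hcpos : 0 < c := lt_of_le_of_ne hc0 (Ne.symm hcz)
        rw [if_neg hcz, ← natCast_mul_devScale_sq hn] at hA
        have hsq : (g / c * devScale n) ^ 2 ≤ ε₁ ^ 2 := by
          refine le_of_mul_le_mul_left ?_ hn0
          calc _ = (g / c) ^ 2 * (n * devScale n ^ 2) := by ring
            _ ≤ _ := hA
        have hle := le_of_sq_le_sq hsq hε.le
        calc g * devScale n = c * (g / c * devScale n) := by field_simp
          _ ≤ c * ε₁ := mul_le_mul_of_nonneg_left hle hc0
  have d₁ : c * ε₁ ≤ const₁ J * ε₁ := mul_le_mul_of_nonneg_right (min_le_left _ _) hε.le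
  have d₃ : c * ε₁ ≤ const₃ J * ε₁ := mul_le_mul_of_nonneg_right (min_le_right _ _) hε.le
  exact hach n hn R₀ (by linarith) (by linarith)

lemma Achievable.mono {PU : U → ℝ} {PYX : X → Y → ℝ} {n : ℕ} {ε ε' : ℝ} (hε : ε ≤ ε')
    {P : U × X × Y × V → ℝ} {R₀ : ℝ} (h : Achievable PU PYX n ε P R₀) :
    Achievable PU PYX n ε' P R₀ :=
  ⟨h.1, h.2.1, h.2.2.imp fun _ hc => hc.trans hε⟩

/-- Since log n = o(n), only finitely many block lengths violate the threshold, which makes κ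
bounded in n. -/
lemma exists_forall_log_le {a ε : ℝ} (ha : 0 < a) (hε : 0 < ε) :
    ∃ N : ℕ, ∀ n : ℕ, N ≤ n → a * Real.log n ≤ n * ε ^ 2 := by
  have h := Real.isLittleO_log_id_atTop.bound (show 0 < ε ^ 2 / a by positivity)
  have h' := tendsto_natCast_atTop_atTop.eventually h
  obtain ⟨N, hN⟩ := Filter.eventually_atTop.1 h'
  refine ⟨N, fun n hn => ?_⟩
  have h1 := hN n hn
  rw [Real.norm_eq_abs, Real.norm_eq_abs, id, abs_of_nonneg (Real.log_natCast_nonneg n),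
    abs_of_nonneg (Nat.cast_nonneg n)] at h1
  calc a * Real.log n ≤ a * (ε ^ 2 / a * n) := by gcongr
    _ = n * ε ^ 2 := by field_simp

end InnerBound

end

end StrongCoord

/-! ### Choice of κ and conclusion -/

theorem mainTheorem1 {U W X Y V : Type*}
    [Fintype U] [Fintype W] [Fintype X] [Fintype Y] [Fintype V]
    (PU : U → ℝ) (hPU : PU ∈ stdSimplex ℝ U)
    (PYX : X → Y → ℝ) (hPYX : ∀ x, PYX x ∈ stdSimplex ℝ Y)
    (B : (StrongCoord.Outcome U W X Y V → ℝ) → ℝ) (hB : ∀ J, 0 ≤ B J) :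
    ∃ κ : (StrongCoord.Outcome U W X Y V → ℝ) → ℝ → ℕ → ℝ,
      (∀ J, ∀ ε₁ > 0, ∃ C : ℝ, ∀ n : ℕ, 1 ≤ n → 0 ≤ κ J ε₁ n ∧ κ J ε₁ n ≤ C) ∧
      (∀ J, ∃ A > 0, ∀ ε₁ > 0, ∀ n : ℕ, 1 ≤ n →
        A * Real.log n ≤ n * ε₁ ^ 2 → κ J ε₁ n = 3 / 2) ∧
      ∀ n : ℕ, 1 ≤ n → ∀ ε₁ > 0, ∀ ε₅ ≥ 0,
        StrongCoord.innerRegion PU PYX n ε₁ ε₅ (fun J => κ J ε₁ n) B ⊆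
          StrongCoord.coordinationRegion PU PYX n
            (10 * ε₅ + (10 + 2 * Real.sqrt 2) / Real.sqrt n) := by
  classical
  open StrongCoord in
  have hthr : ∀ J : Outcome U W X Y V → ℝ, ∃ A > 0, Factorizes PU PYX J →
      ∀ n : ℕ, 1 ≤ n → ∀ ε₁ > 0, A * Real.log n ≤ n * ε₁ ^ 2 → ∀ δ R₀ : ℝ, 0 ≤ δ →
      (2 ≤ n → 0 < δ) →
      mutualInfo J rvW rvU ≤ mutualInfo J rvW rvY - (const₁ J * ε₁ + δ) →
      condMutualInfo J rvW (fun ω => (rvU ω, rvX ω, rvV ω)) rvY + (const₃ J * ε₁ + δ) ≤ R₀ →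
      Achievable PU PYX n (10 / Real.sqrt n)
        (law J (fun ω => (rvU ω, rvX ω, rvY ω, rvV ω))) R₀ := by
    intro J
    -- `A` must be chosen for every `J`; where `J` does not factorize the value is irrelevant, as
    -- such `J` never enter the inner region.
    by_cases h : Factorizes PU PYX J
    · obtain ⟨A, hA, hA'⟩ := h.exists_threshold hPU hPYX
      exact ⟨A, hA, fun _ => hA'⟩
    · exact ⟨1, one_pos, fun h' => absurd h' h⟩
  choose A hA hach using hthr
  let gap : (StrongCoord.Outcome U W X Y V → ℝ) → ℝ := fun J =>
    1 + |StrongCoord.mutualInfo J StrongCoord.rvW StrongCoord.rvY -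
      StrongCoord.mutualInfo J StrongCoord.rvW StrongCoord.rvU|
  have hgap : ∀ J, 0 < gap J := fun J => by positivity
  -- Below the threshold the factor n cancels the 1/n in κ log₂ n / n, leaving `gap J` times log₂ n.
  refine ⟨fun J ε₁ n => if A J * Real.log n ≤ n * ε₁ ^ 2 then 3 / 2 else n * gap J, ?_, ?_, ?_⟩
  · intro J ε₁ hε
    obtain ⟨N, hN⟩ := StrongCoord.exists_forall_log_le (hA J) hε
    refine ⟨max (3 / 2) (N * gap J), fun n _ => ?_⟩
    have := (hgap J).le
    dsimp only
    split_ifs with h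
    · exact ⟨by norm_num, le_max_left _ _⟩
    · refine ⟨by positivity, le_max_of_le_right ?_⟩
      have : n ≤ N := by
        by_contra hlt
        exact h (hN n (by omega))
      gcongr
  · intro J
    exact ⟨A J, hA J, fun ε₁ _ n _ h => if_pos h⟩
  · rintro n hn ε₁ hε ε₅ hε₅ ⟨P, R₀⟩ ⟨J, hJ, rfl, -, h4, h1, h2⟩
    refine subset_closure ?_
    have hn0 : (0 : ℝ) < n := by exact_mod_cast hn
    have hdisp : 0 ≤ StrongCoord.gaussianQInv (ε₅ + B J / Real.sqrt n) *
        Real.sqrt (StrongCoord.channelDispersion J / n) :=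
      mul_nonneg (StrongCoord.gaussianQInv_nonneg h4) (Real.sqrt_nonneg _)
    have hlogn : 0 ≤ Real.logb 2 n / n :=
      div_nonneg (Real.logb_nonneg one_lt_two (by exact_mod_cast hn)) hn0.le
    dsimp only at h1 h2 ⊢
    by_cases hthr : A J * Real.log n ≤ n * ε₁ ^ 2
    · simp only [if_pos hthr, add_assoc] at h1 h2
      refine (hach J hJ n hn ε₁ hε hthr _ R₀ (by positivity) (fun hn2 => ?_) h1 h2).mono ?_
      · have : 0 < Real.logb 2 n := Real.logb_pos one_lt_two (by exact_mod_cast hn2)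
        positivity
      · have : (10 : ℝ) / Real.sqrt n ≤ (10 + 2 * Real.sqrt 2) / Real.sqrt n := by
          gcongr
          linarith [Real.sqrt_nonneg 2]
        linarith
    -- Here n ≥ 2, because log 1 = 0 meets the threshold. So κ log₂ n / n ≥ `gap J` > I(W;Y) −
    -- I(W;U), while the other penalty terms and I(W;U)'s competitors are nonnegative: the first
    -- rate condition fails.
    · exfalso
      simp only [if_neg hthr] at h1
      have hn2 : (2 : ℝ) ≤ n := by
        by_contra hlt
        have : n = 1 := by
          have : n < 2 := by exact_mod_cast not_le.1 hlt
          omega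
        subst this
        refine hthr ?_
        simp only [Nat.cast_one, Real.log_one, mul_zero]
        positivity
      have hmem := hJ.mem_stdSimplex hPU hPYX
      have hc : 0 ≤ StrongCoord.const₁ J * ε₁ :=
        mul_nonneg (add_nonneg (StrongCoord.entropy_nonneg hmem _)
          (StrongCoord.entropy_nonneg hmem _)) hε.le
      have hlogb : 1 ≤ Real.logb 2 n := by
        rw [Real.le_logb_iff_rpow_le one_lt_two hn0]
        simpa using hn2
      have hκ : gap J ≤ n * gap J * (Real.logb 2 n / n) := by
        have : (n : ℝ) * gap J * (Real.logb 2 n / n) = gap J * Real.logb 2 n := by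
          field_simp
        rw [this]
        exact le_mul_of_one_le_right (hgap J).le hlogb
      have habs := le_abs_self (StrongCoord.mutualInfo J StrongCoord.rvW StrongCoord.rvY -
        StrongCoord.mutualInfo J StrongCoord.rvW StrongCoord.rvU)
      have hgd : gap J = 1 + |StrongCoord.mutualInfo J StrongCoord.rvW StrongCoord.rvY -
        StrongCoord.mutualInfo J StrongCoord.rvW StrongCoord.rvU| := rfl
      linarith
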